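/- For integers $r,s\ge 0$ let $\mathrm{Cl}_{r,s}$ be the real Clifford algebra of $\mathbb R^{r,s}$ with $x^2=-\langle x,x\rangle_{r,s}\mathbf 1$, where $\langle x,x\rangle_{r,s}=x_1^2+\dots+x_r^2-x_{r+1}^2-\dots-x_{r+s}^2$, and let $z_1,\dots,z_{r+s}$ be the standard orthonormal basis. Let $G_{r,s}=\{\pm z_{i_1}\cdots z_{i_k}\mid i_1<\dots<i_k,\ k\ge 0\}$ be the finite group generated by $-\mathbf 1$ and the $z_i$. Let $\dim V^{r,s}$ be the smallest dimension of a non-zero finite-dimensional admissible $\mathrm{Cl}_{r,s}$-module, i.e. of a representation $J\colon \mathrm{Cl}_{r,s}\to\mathrm{End}(V)$ on a real vector space with a non-degenerate symmetric bilinear form satisfying $\langle J_zu,v\rangle_V+\langle u,J_zv\rangle_V=0$ for all $z\in\mathbb R^{r,s}$, $u,v\in V$. Let $\mathbb{PI}_{r,s}$ be the collection of sets $PI=\{p_1,\dots,p_\ell\}\subset G_{r,s}$ of pairwise commuting elements $p_i\neq\mathbf 1$ such that $p_i\in \mathrm{Pin}(r,0)\times\mathrm{Spin}(0,s)$ and $p_i^2=\mathbf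 1$ for all $i$, and such that the $2^\ell$ products $p_{i_1}\cdots p_{i_k}$, $1\le i_1<\dots<i_k\le\ell$, $0\le k\le \ell$, are linearly independent in $\mathrm{Cl}_{r,s}$. Let $\mathbb{PI}^M_{r,s}$ consist of those $PI\in\mathbb{PI}_{r,s}$ for which the group $\mathcal S(PI)$ generated by $PI$ satisfies $\#\mathcal S(PI)\cdot 2\dim V^{r,s}=2^{r+s+1}=\# G_{r,s}$. Let $\ell(r,s)$ be the maximal number of involutions in a set $PI\in\mathbb{PI}^M_{r,s}$. Then for all $r,s\ge0$ the number $\ell(r,s)$ is well defined (that is, $\mathbb{PI}^M_{r,s}\ne\emptyset$), it is also the maximal number of involutions in a set $PI\in\mathbb{PI}_{r,s}$, and $$\ell(r+8,s)=\ell(r+4,s+4)=\ell(r,s+8)=\ell(r,s)+4$$ $$=\ell(r,s)+\ell(8,0)=\ell(r,s)+\ell(0,8)=\ell(r,s)+\ell(4,4).$$ -/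

import Mathlib

noncomputable section

namespace PseudoH

/-- The scalar product `⟨x, x⟩_{r,s} = x₁² + ⋯ + x_r² - x_{r+1}² - ⋯ - x_{r+s}²` of `ℝ^{r,s}`,
as a quadratic form; the first `r` coordinates are indexed by `Fin r`, the last `s` by `Fin s`. -/
abbrev eta (r s : ℕ) : QuadraticForm ℝ (Fin r ⊕ Fin s → ℝ) :=
  QuadraticMap.weightedSumSquares ℝ
    (Sum.elim (fun _ => (1 : ℝ)) (fun _ => (-1 : ℝ)) : Fin r ⊕ Fin s → ℝ)

/-- The Clifford algebra `Cl_{r,s}`, with the sign convention `x ⊗ x = - ⟨x, x⟩_{r,s} 1`. -/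
abbrev Cl (r s : ℕ) : Type := CliffordAlgebra (-(eta r s))

/-- The inclusion `ℝ^{r,s} → Cl_{r,s}`. -/
abbrev vec (r s : ℕ) : (Fin r ⊕ Fin s → ℝ) →ₗ[ℝ] Cl r s := CliffordAlgebra.ι (-(eta r s))

/-! ### Minimal admissible modules -/

/-- `J : Cl_{r,s} → End V` together with the bilinear form `B` is an admissible module: `B` is
symmetric, non-degenerate, and every `J_z`, `z ∈ ℝ^{r,s}`, is skew-symmetric for `B`. -/
structure IsAdmissible {r s : ℕ} {V : Type} [AddCommGroup V] [Module ℝ V]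
    (J : Cl r s →ₐ[ℝ] Module.End ℝ V) (B : LinearMap.BilinForm ℝ V) : Prop where
  symm : ∀ u v : V, B u v = B v u
  nondeg : B.Nondegenerate
  skew : ∀ (z : Fin r ⊕ Fin s → ℝ) (u v : V), B (J (vec r s z) u) v + B u (J (vec r s z) v) = 0

/-- The dimension `dim V^{r,s}` of a minimal admissible module: the least dimension of a non-zero
finite-dimensional admissible `Cl_{r,s}`-module. -/
def minAdmissibleDim (r s : ℕ) : ℕ :=
  sInf {N : ℕ | ∃ (V : Type) (_ : AddCommGroup V) (_ : Module ℝ V) (_ : FiniteDimensional ℝ V)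
    (_ : Nontrivial V) (J : Cl r s →ₐ[ℝ] Module.End ℝ V) (B : LinearMap.BilinForm ℝ V),
    IsAdmissible J B ∧ Module.finrank ℝ V = N}

/-! ### The finite group generated by the standard orthonormal basis -/

theorem vec_single_mul_self (r s : ℕ) (i : Fin r ⊕ Fin s) :
    vec r s (Pi.single i 1) * vec r s (Pi.single i 1) =
      algebraMap ℝ (Cl r s) (Sum.elim (fun _ => (-1 : ℝ)) (fun _ => (1 : ℝ)) i) := by
  rw [CliffordAlgebra.ι_sq_scalar]
  congr 1
  rw [neg_apply, QuadraticMap.weightedSumSquares_apply,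
    Finset.sum_eq_single i (fun j _ hj => by simp [hj]) (by simp)]
  cases i <;> simp

/-- The standard orthonormal basis vector `z_i` of `ℝ^{r,s}` as an invertible element of
`Cl_{r,s}`; it is positive for `i : Fin r` and negative for `i : Fin s`. -/
def basisUnit (r s : ℕ) (i : Fin r ⊕ Fin s) : (Cl r s)ˣ where
  val := vec r s (Pi.single i 1)
  inv := (Sum.elim (fun _ => (-1 : ℝ)) (fun _ => (1 : ℝ)) i) • vec r s (Pi.single i 1)
  val_inv := by
    rw [mul_smul_comm, vec_single_mul_self, Algebra.smul_def, ← map_mul]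
    cases i <;> simp
  inv_val := by
    rw [smul_mul_assoc, vec_single_mul_self, Algebra.smul_def, ← map_mul]
    cases i <;> simp

/-- The group `G(B_{r,s})` generated by `-1` and the basis `B_{r,s} = {z_1, …, z_{r+s}}`; its
elements are `± z_{i_1} ⋯ z_{i_k}`. -/
def basisGroup (r s : ℕ) : Subgroup (Cl r s)ˣ :=
  Subgroup.closure ({-1} ∪ Set.range (basisUnit r s))

/-- `Pin(r,0) ⊆ Cl_{r,s}`: all products of vectors `x ∈ ℝ^{r,0}` with `⟨x, x⟩ = 1`. -/
def pinPos (r s : ℕ) : Submonoid (Cl r s) :=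
  Submonoid.closure {a | ∃ x : Fin r ⊕ Fin s → ℝ,
    (∀ j : Fin s, x (Sum.inr j) = 0) ∧ eta r s x = 1 ∧ a = vec r s x}

/-- `Spin(0,s) ⊆ Cl_{r,s}`: all products of an even number of vectors `y ∈ ℝ^{0,s}` with
`⟨y, y⟩ = -1`. -/
def spinNeg (r s : ℕ) : Submonoid (Cl r s) :=
  Submonoid.closure {a | ∃ x y : Fin r ⊕ Fin s → ℝ,
    (∀ i : Fin r, x (Sum.inl i) = 0) ∧ (∀ i : Fin r, y (Sum.inl i) = 0) ∧
    eta r s x = -1 ∧ eta r s y = -1 ∧ a = vec r s x * vec r s y}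

/-! ### Generating sets of positive involutions -/

/-- The product `p_{i_1} ⋯ p_{i_k}` over the elements `i_1 < ⋯ < i_k` of `T` (it is `1` for
`T = ∅`). -/
def orderedProd {r s l : ℕ} (p : Fin l → (Cl r s)ˣ) (T : Finset (Fin l)) : (Cl r s)ˣ :=
  ((T.sort (· ≤ ·)).map p).prod

/-- `PI = {p_1, …, p_l}` is a set of generating positive involutions, i.e. `PI ∈ ℙ𝕀_{r,s}`.
By `linInd` the `p_i` are distinct, so that `l` is the cardinality of the set `PI`. -/
structure IsPI (r s : ℕ) {l : ℕ} (p : Fin l → (Cl r s)ˣ) : Prop where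
  mem : ∀ i, p i ∈ basisGroup r s
  ne_one : ∀ i, p i ≠ 1
  comm : ∀ i j, p i * p j = p j * p i
  pinSpin : ∀ i, ∃ a ∈ pinPos r s, ∃ b ∈ spinNeg r s, (p i : Cl r s) = a * b
  sq : ∀ i, p i ^ 2 = 1
  linInd : LinearIndependent ℝ (fun T : Finset (Fin l) => (orderedProd p T : Cl r s))

/-- `PI ∈ ℙ𝕀^M_{r,s}`: the group `S(PI)` generated by `PI` satisfies
`#S(PI) · 2 dim V^{r,s} = 2^{r+s+1} = #G(B_{r,s})`. -/
structure IsMaxPI (r s : ℕ) {l : ℕ} (p : Fin l → (Cl r s)ˣ) : Prop where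
  isPI : IsPI r s p
  card_eq : Nat.card (Subgroup.closure (Set.range p)) * (2 * minAdmissibleDim r s) =
    2 ^ (r + s + 1)

/-- The cardinalities of the sets `PI ∈ ℙ𝕀_{r,s}`. -/
def piCards (r s : ℕ) : Set ℕ := {l | ∃ p : Fin l → (Cl r s)ˣ, IsPI r s p}

/-- The cardinalities of the sets `PI ∈ ℙ𝕀^M_{r,s}`. -/
def maxPiCards (r s : ℕ) : Set ℕ := {l | ∃ p : Fin l → (Cl r s)ˣ, IsMaxPI r s p}

/-- `ℓ(r,s)`: the maximal number of involutions in a set `PI ∈ ℙ𝕀^M_{r,s}`. -/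
def ell (r s : ℕ) : ℕ := sSup (maxPiCards r s)

end PseudoH

end

/-! Up to sign, an element of `G_{r,s}` is a vector of `F_2^{r+s}`. The sign of its square is a
quadratic form (`quad`) whose polar form (`polar`) is the commutation sign, and lying in `Pin(r,0) ×
Spin(0,s)` up to sign means having evenly many negative coordinates. A set of `l` generating
positive involutions thus amounts to an `l`-dimensional good code (`piCards_eq_codeDims`).

Periodicity is a statement about codes. The extended Hamming code of length eight is self-dual, has
weights divisible by four and has even weight on each half. Adding it as a direct summand gains four
dimensions (`add_four_mem_codeDims`), and its self-duality forbids more (`exists_le_add_four`). The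
even halves treat `(8,0)`, `(4,4)` and `(0,8)` alike.

The link with modules is `2^l · dim V^{r,s} = 2^{r+s}` for the greatest `l`
(`two_pow_mul_minAdmissibleDim`). For `≤`, averaging over `S(PI)` gives a self-conjugate idempotent
`e`, and the left ideal `Cl e` is an admissible module of dimension `2^{r+s-l}`. For `≥`, any
admissible module contains a non-isotropic common eigenvector of a maximal good code `C`; maximality
makes its translates by representatives of the cosets of `C` linearly independent. So a set of
greatest size in `PI` satisfies the cardinality condition, and the two maxima coincide. -/

namespace PseudoH

/-! ### Binary codes -/

section Codes

variable {ι κ : Type*} [Fintype ι] [Fintype κ]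

/-- The number of non-zero coordinates of a binary vector, modulo four. -/
def weight (a : ι → ZMod 2) : ZMod 4 := ∑ i, ((a i).val : ZMod 4)

/-- The parity of the triangular number `n (n + 1) / 2`, as a function of `n` modulo four. -/
def triParity (x : ZMod 4) : ZMod 2 := if x = 0 ∨ x = 3 then 0 else 1

/-- The doubling map from `ZMod 2` to `ZMod 4`. -/
def double : ZMod 2 →+ ZMod 4 where
  toFun x := 2 * (x.val : ZMod 4)
  map_zero' := by decide
  map_add' := by decide

/-- The bilinear form `(a, b) ↦ |a| |b| - |a ∩ b|` of the commutation signs. -/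
def polar (a b : ι → ZMod 2) : ZMod 2 := (∑ i, a i) * (∑ i, b i) + a ⬝ᵥ b

/-- The quadratic form of the signs of squares; `ν` is the indicator of the negative
coordinates. -/
def quad (ν a : ι → ZMod 2) : ZMod 2 := triParity (weight a) + ν ⬝ᵥ a

theorem zmod_two_cases (x : ZMod 2) : x = 0 ∨ x = 1 := by
  revert x; decide

/-- Inclusion-exclusion: `|a + b| = |a| + |b| - 2|a ∩ b|`, where the sign of the last term is
immaterial modulo four. -/
theorem weight_add (a b : ι → ZMod 2) :
    weight (a + b) = weight a + weight b + double (a ⬝ᵥ b) := by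
  simp only [weight, dotProduct, map_sum, ← Finset.sum_add_distrib]
  refine Finset.sum_congr rfl fun i _ => ?_
  simp only [Pi.add_apply]
  generalize a i = x
  generalize b i = y
  revert x y
  decide

theorem castHom_weight (a : ι → ZMod 2) :
    ZMod.castHom (by decide : 2 ∣ 4) (ZMod 2) (weight a) = ∑ i, a i := by
  simp only [weight, map_sum]
  refine Finset.sum_congr rfl fun i _ => ?_
  generalize a i = x
  revert x
  decide

/-- With `T n = n(n+1)/2` one has `T(x + y) = T x + T y + xy`, and `T(n + 2k) ≡ T n + k` modulo two.
-/
theorem triParity_add (x y : ZMod 4) (k : ZMod 2) :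
    triParity (x + y + double k) = triParity x + triParity y +
      (ZMod.castHom (by decide : 2 ∣ 4) (ZMod 2) x * ZMod.castHom (by decide : 2 ∣ 4) (ZMod 2) y
        + k) := by
  revert x y k
  decide

theorem triParity_weight_add (a b : ι → ZMod 2) :
    triParity (weight (a + b)) = triParity (weight a) + triParity (weight b) + polar a b := by
  rw [weight_add, triParity_add, castHom_weight, castHom_weight, polar]

theorem quad_add (ν a b : ι → ZMod 2) : quad ν (a + b) = quad ν a + quad ν b + polar a b := by
  simp only [quad, triParity_weight_add, dotProduct_add]
  ring

theorem polar_add_left (a b c : ι → ZMod 2) : polar (a + b) c = polar a c + polar b c := by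
  simp only [polar, Pi.add_apply, Finset.sum_add_distrib, add_dotProduct]
  ring

theorem polar_add_right (a b c : ι → ZMod 2) : polar a (b + c) = polar a b + polar a c := by
  simp only [polar, Pi.add_apply, Finset.sum_add_distrib, dotProduct_add]
  ring

@[simp] theorem polar_zero_left (a : ι → ZMod 2) : polar 0 a = 0 := by simp [polar]

@[simp] theorem polar_zero_right (a : ι → ZMod 2) : polar a 0 = 0 := by simp [polar]

@[simp] theorem weight_zero : weight (0 : ι → ZMod 2) = 0 := by simp [weight]

theorem weight_single [DecidableEq ι] (i : ι) : weight (Pi.single i (1 : ZMod 2)) = 1 := by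
  rw [weight, Finset.sum_eq_single i (fun j _ hj => by simp [hj]) (by simp)]
  simp [show (1 : ZMod 2).val = 1 from rfl]

theorem quad_zero (ν : ι → ZMod 2) : quad ν 0 = 0 := by simp [quad, triParity]

theorem quad_single [DecidableEq ι] (ν : ι → ZMod 2) (i : ι) :
    quad ν (Pi.single i 1) = 1 + ν i := by
  rw [quad, weight_single]
  simp [show triParity 1 = 1 by decide]

/-- All vectors of the code are supports of positive involutions. -/
def IsGood (ν : ι → ZMod 2) (C : Submodule (ZMod 2) (ι → ZMod 2)) : Prop :=
  ∀ c ∈ C, triParity (weight c) = 0 ∧ ν ⬝ᵥ c = 0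

/-- The dimensions of the good codes. -/
def codeDims (ν : ι → ZMod 2) : Set ℕ :=
  {l | ∃ C : Submodule (ZMod 2) (ι → ZMod 2), IsGood ν C ∧ Module.finrank (ZMod 2) C = l}

/-- A quadratic form vanishing on a subspace has vanishing polar form there: if all products square
to one, the factors commute. -/
theorem IsGood.polar_eq_zero {ν : ι → ZMod 2} {C : Submodule (ZMod 2) (ι → ZMod 2)}
    (hC : IsGood ν C) {a b : ι → ZMod 2} (ha : a ∈ C) (hb : b ∈ C) : polar a b = 0 := by
  have h := triParity_weight_add a b
  rw [(hC _ (C.add_mem ha hb)).1, (hC _ ha).1, (hC _ hb).1] at h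
  simpa using h.symm

theorem IsGood.quad_eq_zero {ν : ι → ZMod 2} {C : Submodule (ZMod 2) (ι → ZMod 2)}
    (hC : IsGood ν C) {a : ι → ZMod 2} (ha : a ∈ C) : quad ν a = 0 := by
  simp [quad, hC a ha]

theorem le_card_of_mem_codeDims {ν : ι → ZMod 2} {l : ℕ} (hl : l ∈ codeDims ν) :
    l ≤ Fintype.card ι := by
  obtain ⟨C, -, rfl⟩ := hl
  simpa using C.finrank_le

theorem exists_isGreatest_codeDims (ν : ι → ZMod 2) : ∃ l, IsGreatest (codeDims ν) l := by
  have hne : (codeDims ν).Nonempty := by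
    refine ⟨0, ⊥, fun c hc => ?_, by simp⟩
    rw [Submodule.mem_bot] at hc
    simp [hc, triParity]
  have hbdd : BddAbove (codeDims ν) := ⟨Fintype.card ι, fun l => le_card_of_mem_codeDims⟩
  exact ⟨_, Nat.sSup_mem hne hbdd, fun l hl => le_csSup hbdd hl⟩

/-- A vector that could be added to a good code of greatest dimension belongs to it. -/
theorem IsGood.mem_of_isGreatest {ν : ι → ZMod 2} {C : Submodule (ZMod 2) (ι → ZMod 2)}
    (hC : IsGood ν C) (hmax : IsGreatest (codeDims ν) (Module.finrank (ZMod 2) C))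
    {a : ι → ZMod 2} (ha : quad ν a = 0) (hν : ν ⬝ᵥ a = 0) (hp : ∀ c ∈ C, polar a c = 0) :
    a ∈ C := by
  -- Adjoining `a` keeps the code good, since the cross terms `polar a c` vanish; greatest dimension
  -- then rules out a proper enlargement.
  have hgood : IsGood ν (C ⊔ Submodule.span (ZMod 2) {a}) := by
    intro x hx
    obtain ⟨c, hc, y, hy, rfl⟩ := Submodule.mem_sup.1 hx
    obtain ⟨k, rfl⟩ := Submodule.mem_span_singleton.1 hy
    have ha' : triParity (weight a) = 0 := by simpa [quad, hν] using ha
    rcases zmod_two_cases k with rfl | rfl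
    · simpa using hC c hc
    · rw [one_smul, add_comm c a]
      refine ⟨?_, by rw [dotProduct_add, hν, (hC c hc).2, add_zero]⟩
      rw [triParity_weight_add, ha', (hC c hc).1, hp c hc]
      simp
  have hle := hmax.2 ⟨_, hgood, rfl⟩
  have heq := Submodule.eq_of_le_of_finrank_le (le_sup_left) hle
  rw [heq]
  exact Submodule.mem_sup_right (Submodule.mem_span_singleton_self a)

theorem weight_comp_equiv (e : κ ≃ ι) (a : ι → ZMod 2) : weight (a ∘ e) = weight a :=
  Equiv.sum_comp e fun i => ((a i).val : ZMod 4)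

theorem codeDims_comp_subset (ν : ι → ZMod 2) (e : κ ≃ ι) :
    codeDims ν ⊆ codeDims (ν ∘ e) := by
  rintro l ⟨C, hC, rfl⟩
  let f := LinearEquiv.funCongrLeft (ZMod 2) (ZMod 2) e
  refine ⟨C.map f.toLinearMap, ?_, LinearEquiv.finrank_map_eq f C⟩
  rintro _ ⟨c, hc, rfl⟩
  obtain ⟨h1, h2⟩ := hC c hc
  refine ⟨(congrArg triParity (weight_comp_equiv e c)).trans h1, ?_⟩
  rw [← h2]
  exact Equiv.sum_comp e fun i => ν i * c i

theorem codeDims_comp_equiv (ν : ι → ZMod 2) (e : κ ≃ ι) : codeDims (ν ∘ e) = codeDims ν := by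
  refine Set.Subset.antisymm ?_ (codeDims_comp_subset ν e)
  have h := codeDims_comp_subset (ν ∘ e) e.symm
  rwa [Function.comp_assoc, Equiv.self_comp_symm, Function.comp_id] at h

/-! ### The extended Hamming code -/

/-- The `(u, u + v)` parametrization of the extended Hamming code of length eight. -/
def hammingMap : (Fin 4 → ZMod 2) →ₗ[ZMod 2] (Fin 4 ⊕ Fin 4 → ZMod 2) where
  toFun k := Sum.elim ![k 0, k 1, k 2, k 0 + k 1 + k 2]
    ![k 0 + k 3, k 1 + k 3, k 2 + k 3, k 0 + k 1 + k 2 + k 3]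
  map_add' x y := by
    ext i
    rcases i with i | i <;> fin_cases i <;> simp <;> ring
  map_smul' c x := by
    ext i
    rcases i with i | i <;> fin_cases i <;> simp <;> ring

theorem hammingMap_injective : Function.Injective hammingMap := by
  intro x y h
  have h0 := congrFun h (Sum.inl 0)
  have h1 := congrFun h (Sum.inl 1)
  have h2 := congrFun h (Sum.inl 2)
  have h3 := congrFun h (Sum.inr 0)
  simp only [hammingMap, LinearMap.coe_mk, AddHom.coe_mk, Sum.elim_inl, Sum.elim_inr,
    Matrix.cons_val_zero, Matrix.cons_val_one, Matrix.cons_val] at h0 h1 h2 h3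
  rw [h0, add_right_inj] at h3
  ext i
  fin_cases i <;> assumption

/-- The extended Hamming code of length eight. -/
def hamming : Submodule (ZMod 2) (Fin 4 ⊕ Fin 4 → ZMod 2) := LinearMap.range hammingMap

theorem finrank_hamming : Module.finrank (ZMod 2) hamming = 4 := by
  rw [hamming, LinearMap.finrank_range_of_inj hammingMap_injective]
  simp

theorem weight_of_mem_hamming {h : Fin 4 ⊕ Fin 4 → ZMod 2} (hh : h ∈ hamming) :
    weight h = 0 := by
  obtain ⟨k, rfl⟩ := hh
  simp only [weight, hammingMap, LinearMap.coe_mk, AddHom.coe_mk, Fintype.sum_sum_type,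
    Fin.sum_univ_four, Sum.elim_inl, Sum.elim_inr, Matrix.cons_val]
  generalize k 0 = a
  generalize k 1 = b
  generalize k 2 = c
  generalize k 3 = d
  revert a b c d
  decide

/-- Each half of a codeword has even weight, so a constant sign on either half is invisible. -/
theorem elim_dotProduct_of_mem_hamming {h : Fin 4 ⊕ Fin 4 → ZMod 2} (hh : h ∈ hamming)
    (c d : ZMod 2) : (Sum.elim (fun _ => c) (fun _ => d) : Fin 4 ⊕ Fin 4 → ZMod 2) ⬝ᵥ h = 0 := by
  obtain ⟨k, rfl⟩ := hh
  simp only [dotProduct, hammingMap, LinearMap.coe_mk, AddHom.coe_mk, Fintype.sum_sum_type,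
    Fin.sum_univ_four, Sum.elim_inl, Sum.elim_inr, Matrix.cons_val]
  generalize k 0 = x
  generalize k 1 = y
  generalize k 2 = z
  generalize k 3 = w
  revert x y z w c d
  decide

/-- The half of self-duality needed for the upper bound. Orthogonality to the four basis codewords
already suffices; the witness reads the parameters off `y`. -/
theorem mem_hamming_of_dotProduct {y : Fin 4 ⊕ Fin 4 → ZMod 2}
    (hy : ∀ h ∈ hamming, y ⬝ᵥ h = 0) : y ∈ hamming := by
  have h0 := hy _ ⟨Pi.single 0 1, rfl⟩
  have h1 := hy _ ⟨Pi.single 1 1, rfl⟩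
  have h2 := hy _ ⟨Pi.single 2 1, rfl⟩
  have h3 := hy _ ⟨Pi.single 3 1, rfl⟩
  refine ⟨![y (Sum.inl 0), y (Sum.inl 1), y (Sum.inl 2), y (Sum.inl 3) + y (Sum.inr 3)], ?_⟩
  simp [dotProduct, hammingMap, Fin.sum_univ_four] at h0 h1 h2 h3
  ext i
  rcases i with i | i <;> fin_cases i <;>
    simp [hammingMap] <;> revert h0 h1 h2 h3 <;>
    generalize y (Sum.inl 0) = a0 <;> generalize y (Sum.inl 1) = a1 <;>
    generalize y (Sum.inl 2) = a2 <;> generalize y (Sum.inl 3) = a3 <;>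
    generalize y (Sum.inr 0) = b0 <;> generalize y (Sum.inr 1) = b1 <;>
    generalize y (Sum.inr 2) = b2 <;> generalize y (Sum.inr 3) = b3 <;>
    revert a0 a1 a2 a3 b0 b1 b2 b3 <;> decide

end Codes

/-! ### Eight additional coordinates and periodicity of good codes. -/

section Periodicity

variable {ι κ : Type*} [Fintype ι] [Fintype κ]

theorem weight_sum (a : ι ⊕ κ → ZMod 2) :
    weight a = weight (a ∘ Sum.inl) + weight (a ∘ Sum.inr) := by
  simp [weight, Fintype.sum_sum_type]

theorem elim_dotProduct (ν : ι → ZMod 2) (μ : κ → ZMod 2) (a : ι ⊕ κ → ZMod 2) :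
    Sum.elim ν μ ⬝ᵥ a = ν ⬝ᵥ (a ∘ Sum.inl) + μ ⬝ᵥ (a ∘ Sum.inr) := by
  simp [dotProduct, Fintype.sum_sum_type]

theorem add_four_mem_codeDims {ν : ι → ZMod 2} {l : ℕ} (hl : l ∈ codeDims ν) (c d : ZMod 2) :
    l + 4 ∈ codeDims
      (Sum.elim ν (Sum.elim (fun _ => c) (fun _ => d) : Fin 4 ⊕ Fin 4 → ZMod 2)) := by
  obtain ⟨C, hC, rfl⟩ := hl
  let f : (C × hamming) →ₗ[ZMod 2] (ι ⊕ (Fin 4 ⊕ Fin 4) → ZMod 2) :=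
    (LinearEquiv.sumArrowLequivProdArrow ι (Fin 4 ⊕ Fin 4) (ZMod 2) (ZMod 2)).symm.toLinearMap ∘ₗ
      C.subtype.prodMap hamming.subtype
  have hf : Function.Injective f :=
    (LinearEquiv.sumArrowLequivProdArrow ι (Fin 4 ⊕ Fin 4) (ZMod 2) (ZMod 2)).symm.injective.comp
      (Prod.map_injective.2 ⟨Subtype.val_injective, Subtype.val_injective⟩)
  refine ⟨LinearMap.range f, ?_, ?_⟩
  · rintro _ ⟨⟨x, h⟩, rfl⟩
    have hx : f (x, h) ∘ Sum.inl = x.1 := rfl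
    have hh : f (x, h) ∘ Sum.inr = h.1 := rfl
    rw [weight_sum, elim_dotProduct, hx, hh, weight_of_mem_hamming h.2,
      elim_dotProduct_of_mem_hamming h.2, add_zero, add_zero]
    exact hC _ x.2
  · rw [LinearMap.finrank_range_of_inj hf, Module.finrank_prod, finrank_hamming]

/-- Pair the last eight coordinates of `C` with the Hamming code `H` (`φ`), and let `U` be the part
of `H` contained in `C`. Then `rank φ ≤ 4 - dim U`, while the words of `ker φ` have tails in `H^⊥ =
H`. Deleting these tails (`ψ`) leaves a good code and loses at most `dim U`, so the total loss is at
most four. -/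
theorem exists_le_add_four {ν : ι → ZMod 2} {c d : ZMod 2} {l : ℕ} (hl : l ∈ codeDims
      (Sum.elim ν (Sum.elim (fun _ => c) (fun _ => d) : Fin 4 ⊕ Fin 4 → ZMod 2))) :
    ∃ k ∈ codeDims ν, l ≤ k + 4 := by
  obtain ⟨C, hC, rfl⟩ := hl
  let φ : C →ₗ[ZMod 2] Module.Dual (ZMod 2) hamming :=
    LinearMap.mk₂ (ZMod 2) (fun x h => (x.1 ∘ Sum.inr) ⬝ᵥ h.1)
      (fun x y h => add_dotProduct (x.1 ∘ Sum.inr) (y.1 ∘ Sum.inr) h.1)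
      (fun k x h => smul_dotProduct k (x.1 ∘ Sum.inr) h.1)
      (fun x h h' => dotProduct_add (x.1 ∘ Sum.inr) h.1 h'.1)
      (fun k x h => dotProduct_smul k (x.1 ∘ Sum.inr) h.1)
  let j : hamming →ₗ[ZMod 2] (ι ⊕ (Fin 4 ⊕ Fin 4) → ZMod 2) :=
    (LinearEquiv.sumArrowLequivProdArrow ι (Fin 4 ⊕ Fin 4) (ZMod 2) (ZMod 2)).symm.toLinearMap ∘ₗ
      LinearMap.inr (ZMod 2) _ _ ∘ₗ hamming.subtype
  have hjl (h : hamming) : j h ∘ Sum.inl = 0 := rfl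
  have hjr (h : hamming) : j h ∘ Sum.inr = h.1 := rfl
  let U : Submodule (ZMod 2) hamming := C.comap j
  -- Words of `C` are mutually orthogonal for `polar`, which is the dot product when one argument is
  -- a Hamming word, as that has even weight.
  have hφ : LinearMap.range φ ≤ U.dualAnnihilator := by
    rintro _ ⟨x, rfl⟩
    rw [Submodule.mem_dualAnnihilator]
    intro h hh
    have hp := hC.polar_eq_zero x.2 (show j h ∈ C from hh)
    have hs : ∑ i, j h i = 0 := by
      rw [← castHom_weight, weight_sum, hjl, hjr, weight_of_mem_hamming h.2]
      simp
    have hd : x.1 ⬝ᵥ j h = (x.1 ∘ Sum.inr) ⬝ᵥ h.1 := by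
      have := elim_dotProduct (x.1 ∘ Sum.inl) (x.1 ∘ Sum.inr) (j h)
      rwa [Sum.elim_comp_inl_inr, hjl, hjr, dotProduct_zero, zero_add] at this
    rwa [polar, hs, mul_zero, zero_add, hd] at hp
  have hK (x : LinearMap.ker φ) : (x.1.1 ∘ Sum.inr) ∈ hamming :=
    mem_hamming_of_dotProduct fun h hh =>
      LinearMap.congr_fun (LinearMap.mem_ker.1 x.2) (⟨h, hh⟩ : hamming)
  let ψ : LinearMap.ker φ →ₗ[ZMod 2] (ι → ZMod 2) :=
    LinearMap.funLeft (ZMod 2) (ZMod 2) Sum.inl ∘ₗ C.subtype ∘ₗ (LinearMap.ker φ).subtype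
  have hψ (x : LinearMap.ker φ) : ψ x = x.1.1 ∘ Sum.inl := rfl
  -- A word of `ker ψ` is only its tail, hence an element of `U`.
  let χ : LinearMap.ker ψ →ₗ[ZMod 2] hamming :=
    LinearMap.codRestrict hamming
      (LinearMap.funLeft (ZMod 2) (ZMod 2) Sum.inr ∘ₗ C.subtype ∘ₗ (LinearMap.ker φ).subtype ∘ₗ
        (LinearMap.ker ψ).subtype) (fun x => hK x.1)
  have hχ (x : LinearMap.ker ψ) : j (χ x) = x.1.1.1 := by
    have h0 : x.1.1.1 ∘ Sum.inl = 0 := x.2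
    ext i
    rcases i with i | i
    · exact (congrFun h0 i).symm
    · rfl
  have hχinj : Function.Injective χ := by
    intro x y hxy
    have := congrArg j hxy
    rw [hχ, hχ] at this
    exact Subtype.ext (Subtype.ext (Subtype.ext this))
  have hχU : LinearMap.range χ ≤ U := by
    rintro _ ⟨x, rfl⟩
    change j (χ x) ∈ C
    rw [hχ]
    exact x.1.1.2
  have h1 := LinearMap.finrank_range_add_finrank_ker φ
  have h2 := LinearMap.finrank_range_add_finrank_ker ψ
  have h3 := Submodule.finrank_mono hφ
  have h4 := Subspace.finrank_add_finrank_dualAnnihilator_eq U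
  have h5 := Submodule.finrank_mono hχU
  rw [LinearMap.finrank_range_of_inj hχinj] at h5
  rw [finrank_hamming] at h4
  refine ⟨_, ⟨LinearMap.range ψ, ?_, rfl⟩, by omega⟩
  rintro _ ⟨x, rfl⟩
  -- A Hamming tail changes neither the weight modulo four nor the parity of negative coordinates.
  have hx := hC _ x.1.2
  rw [weight_sum, elim_dotProduct, weight_of_mem_hamming (hK x),
    elim_dotProduct_of_mem_hamming (hK x), add_zero, add_zero] at hx
  exact hx

/-- Eight further coordinates raise the greatest dimension of a good code by four. -/
theorem isGreatest_codeDims_add_four {ν : ι → ZMod 2} {ν' : κ → ZMod 2} {l : ℕ}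
    (hl : IsGreatest (codeDims ν) l) (c d : ZMod 2) (e : ι ⊕ (Fin 4 ⊕ Fin 4) ≃ κ)
    (he : ν' ∘ e = Sum.elim ν (Sum.elim (fun _ => c) (fun _ => d))) :
    IsGreatest (codeDims ν') (l + 4) := by
  rw [← codeDims_comp_equiv ν' e, he]
  refine ⟨add_four_mem_codeDims hl.1 c d, fun m hm => ?_⟩
  obtain ⟨k, hk, hmk⟩ := exists_le_add_four hm
  have := hl.2 hk
  omega

end Periodicity

/-- The indicator of the negative coordinates of `ℝ^{r,s}`. -/
def negInd (r s : ℕ) : Fin r ⊕ Fin s → ZMod 2 := Sum.elim (fun _ => 0) (fun _ => 1)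

/-- `Fin (n + 8)` as a disjoint union. -/
def finAddEightEquiv (n : ℕ) : Fin n ⊕ (Fin 4 ⊕ Fin 4) ≃ Fin (n + 8) :=
  (Equiv.sumCongr (Equiv.refl _) finSumFinEquiv).trans finSumFinEquiv

theorem isGreatest_codeDims_eight_zero {r s l : ℕ} (hl : IsGreatest (codeDims (negInd r s)) l) :
    IsGreatest (codeDims (negInd (r + 8) s)) (l + 4) := by
  refine isGreatest_codeDims_add_four hl 0 0
    ((Equiv.sumAssoc _ _ _).trans ((Equiv.sumCongr (Equiv.refl _) (Equiv.sumComm _ _)).trans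
      ((Equiv.sumAssoc _ _ _).symm.trans
        (Equiv.sumCongr (finAddEightEquiv r) (Equiv.refl _))))) ?_
  ext ((i | i) | (i | i)) <;> rfl

theorem isGreatest_codeDims_zero_eight {r s l : ℕ} (hl : IsGreatest (codeDims (negInd r s)) l) :
    IsGreatest (codeDims (negInd r (s + 8))) (l + 4) := by
  refine isGreatest_codeDims_add_four hl 1 1
    ((Equiv.sumAssoc _ _ _).trans (Equiv.sumCongr (Equiv.refl _) (finAddEightEquiv s))) ?_
  ext ((i | i) | (i | i)) <;> rfl

theorem isGreatest_codeDims_four_four {r s l : ℕ} (hl : IsGreatest (codeDims (negInd r s)) l) :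
    IsGreatest (codeDims (negInd (r + 4) (s + 4))) (l + 4) := by
  refine isGreatest_codeDims_add_four hl 0 1
    ((Equiv.sumSumSumComm _ _ _ _).trans
      (Equiv.sumCongr finSumFinEquiv finSumFinEquiv)) ?_
  ext ((i | i) | (i | i)) <;> rfl

/-! ### Signs -/

section Signs

variable {M : Type*} [Monoid M] [HasDistribNeg M]

/-- The sign `(-1) ^ k`. -/
def sgn (k : ZMod 2) : M := (-1) ^ k.val

@[simp] theorem sgn_zero : (sgn 0 : M) = 1 := by simp [sgn]

@[simp] theorem sgn_one : (sgn 1 : M) = -1 := by simp [sgn, show (1 : ZMod 2).val = 1 from rfl]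

theorem sgn_add (j k : ZMod 2) : (sgn (j + k) : M) = sgn j * sgn k := by
  rcases zmod_two_cases j with rfl | rfl <;> rcases zmod_two_cases k with rfl | rfl <;>
    simp [show (1 + 1 : ZMod 2) = 0 from rfl]

theorem sgn_mul_comm (k : ZMod 2) (x : M) : sgn k * x = x * sgn k := by
  rcases zmod_two_cases k with rfl | rfl <;> simp

@[simp] theorem sgn_mul_self (k : ZMod 2) : (sgn k * sgn k : M) = 1 := by
  rcases zmod_two_cases k with rfl | rfl <;> simp

theorem sgn_real_smul {A : Type*} [Ring A] [Algebra ℝ A] (k : ZMod 2) (x : A) :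
    (sgn k : ℝ) • x = sgn k * x := by
  rcases zmod_two_cases k with rfl | rfl <;> simp

end Signs

variable {r s : ℕ}

@[simp] theorem coe_sgn (k : ZMod 2) : ((sgn k : (Cl r s)ˣ) : Cl r s) = sgn k := by
  rcases zmod_two_cases k with rfl | rfl <;> simp

theorem unit_neg_one_ne_one : (-1 : (Cl r s)ˣ) ≠ 1 := by
  intro h
  have h' : (-1 : Cl r s) = 1 := by simpa using congrArg Units.val h
  have h2 : (2 : ℝ) • (1 : Cl r s) = 0 := by
    rw [two_smul]
    nth_rewrite 1 [← h']
    simp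
  rcases smul_eq_zero.1 h2 with h | h
  · norm_num at h
  · exact one_ne_zero h

theorem basisUnit_mul_self (i : Fin r ⊕ Fin s) :
    basisUnit r s i * basisUnit r s i = sgn (1 + negInd r s i) := by
  ext
  rw [Units.val_mul, coe_sgn]
  refine (vec_single_mul_self r s i).trans ?_
  rcases i with i | i <;> simp [negInd, show (1 + 1 : ZMod 2) = 0 from rfl]

theorem basisUnit_anticomm {i j : Fin r ⊕ Fin s} (hij : i ≠ j) :
    basisUnit r s i * basisUnit r s j = -(basisUnit r s j * basisUnit r s i) := by
  ext
  rw [Units.val_neg, Units.val_mul, Units.val_mul]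
  refine CliffordAlgebra.ι_mul_ι_comm_of_isOrtho ?_
  rw [QuadraticMap.isOrtho_def]
  simp only [neg_apply, QuadraticMap.weightedSumSquares_apply, ← neg_add,
    ← Finset.sum_add_distrib]
  refine congrArg _ (Finset.sum_congr rfl fun k _ => ?_)
  by_cases hk : k = i
  · subst hk
    simp [hij]
  · simp [hk]

/-! ### Supports of the elements of the basis group -/

/-- `HasSupport g a`: up to sign, `g` is the product of the basis vectors `z_i`, `a i = 1`. -/
inductive HasSupport : (Cl r s)ˣ → (Fin r ⊕ Fin s → ZMod 2) → Prop
  | one : HasSupport 1 0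
  | neg {g : (Cl r s)ˣ} {a : Fin r ⊕ Fin s → ZMod 2} (h : HasSupport g a) : HasSupport (-g) a
  | basis_mul (i : Fin r ⊕ Fin s) {g : (Cl r s)ˣ} {a : Fin r ⊕ Fin s → ZMod 2}
      (h : HasSupport g a) : HasSupport (basisUnit r s i * g) (Pi.single i 1 + a)

theorem neg_one_mem_basisGroup : (-1 : (Cl r s)ˣ) ∈ basisGroup r s :=
  Subgroup.subset_closure (Or.inl rfl)

theorem basisUnit_mem_basisGroup (i : Fin r ⊕ Fin s) : basisUnit r s i ∈ basisGroup r s :=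
  Subgroup.subset_closure (Or.inr ⟨i, rfl⟩)

namespace HasSupport

variable {g h : (Cl r s)ˣ} {a b : Fin r ⊕ Fin s → ZMod 2}

theorem mem_basisGroup (hg : HasSupport g a) : g ∈ basisGroup r s := by
  induction hg with
  | one => exact one_mem _
  | neg _ ih => simpa using mul_mem neg_one_mem_basisGroup ih
  | basis_mul i _ ih => exact mul_mem (basisUnit_mem_basisGroup i) ih

theorem basis (i : Fin r ⊕ Fin s) : HasSupport (basisUnit r s i) (Pi.single i 1) := by
  simpa using basis_mul i one

theorem mul (hg : HasSupport g a) (hh : HasSupport h b) : HasSupport (g * h) (a + b) := by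
  induction hg with
  | one => simpa using hh
  | neg _ ih => simpa using ih.neg
  | basis_mul i _ ih => simpa only [mul_assoc, add_assoc] using ih.basis_mul i

theorem sgn_mul (k : ZMod 2) (hg : HasSupport g a) : HasSupport (sgn k * g) a := by
  rcases zmod_two_cases k with rfl | rfl
  · simpa using hg
  · simpa using hg.neg

theorem basis_comm (i : Fin r ⊕ Fin s) (hg : HasSupport g a) :
    basisUnit r s i * g = sgn (polar (Pi.single i 1) a) * (g * basisUnit r s i) := by
  induction hg with
  | one => simp
  | neg _ ih => simp [ih]
  | @basis_mul j g a _ ih =>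
    have hij : basisUnit r s i * basisUnit r s j =
        sgn (polar (Pi.single i 1) (Pi.single j 1)) * (basisUnit r s j * basisUnit r s i) := by
      by_cases h : i = j
      · subst h
        simp [polar, show (1 + 1 : ZMod 2) = 0 from rfl]
      · rw [basisUnit_anticomm h]
        simp [polar, h]
    rw [polar_add_right, sgn_add, ← mul_assoc, hij, mul_assoc, mul_assoc, ih, mul_assoc]
    congr 1
    rw [← mul_assoc (basisUnit r s j), ← sgn_mul_comm, mul_assoc, mul_assoc]

theorem comm (hg : HasSupport g a) (hh : HasSupport h b) :
    g * h = sgn (polar a b) * (h * g) := by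
  induction hg with
  | one => simp
  | neg _ ih => simp [ih]
  | basis_mul i _ ih =>
    rw [polar_add_left, sgn_add, mul_assoc, ih, ← mul_assoc, ← sgn_mul_comm, mul_assoc,
      ← mul_assoc (basisUnit r s i), hh.basis_comm, sgn_mul_comm (polar (Pi.single i 1) b)
        (sgn (polar _ b))]
    simp only [mul_assoc]

/-- From `(z g)² = z² g²` times the commutation sign of `z` and `g`, the sign of the square obeys
the recursion of `quad`. -/
theorem mul_self (hg : HasSupport g a) : g * g = sgn (quad (negInd r s) a) := by
  induction hg with
  | one => simp [quad_zero]
  | neg _ ih => simp [ih]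
  | @basis_mul i g a hg ih =>
    rw [quad_add, quad_single, mul_assoc, ← mul_assoc g]
    have := hg.comm (basis i)
    rw [this, mul_assoc, mul_assoc, ih, ← mul_assoc, ← sgn_mul_comm, mul_assoc,
      ← mul_assoc (basisUnit r s i), basisUnit_mul_self, sgn_add, sgn_add]
    rw [show polar a (Pi.single i 1) = polar (Pi.single i 1) a by
      simp only [polar]; rw [mul_comm, dotProduct_comm]]
    rw [sgn_mul_comm]
    simp only [sgn_add]

theorem inv (hg : HasSupport g a) : HasSupport g⁻¹ a := by
  have h : g⁻¹ = sgn (quad (negInd r s) a) * g := by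
    rw [← hg.mul_self]
    have h2 : (g * g) * (g * g) = 1 := by rw [hg.mul_self, sgn_mul_self]
    rw [inv_eq_iff_mul_eq_one]
    simpa only [mul_assoc] using h2
  rw [h]
  exact hg.sgn_mul _

end HasSupport

theorem exists_hasSupport_of_mem {g : (Cl r s)ˣ} (hg : g ∈ basisGroup r s) :
    ∃ a, HasSupport g a := by
  induction hg using Subgroup.closure_induction with
  | mem x hx =>
    rcases hx with rfl | ⟨i, rfl⟩
    · exact ⟨0, HasSupport.one.neg⟩
    · exact ⟨_, HasSupport.basis i⟩
  | one => exact ⟨0, HasSupport.one⟩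
  | mul x y _ _ hx hy =>
    obtain ⟨a, ha⟩ := hx
    obtain ⟨b, hb⟩ := hy
    exact ⟨_, ha.mul hb⟩
  | inv x _ hx =>
    obtain ⟨a, ha⟩ := hx
    exact ⟨a, ha.inv⟩

theorem exists_hasSupport (a : Fin r ⊕ Fin s → ZMod 2) : ∃ g : (Cl r s)ˣ, HasSupport g a := by
  let N : AddSubmonoid (Fin r ⊕ Fin s → ZMod 2) :=
    { carrier := {a | ∃ g : (Cl r s)ˣ, HasSupport g a}
      zero_mem' := ⟨1, HasSupport.one⟩
      add_mem' := fun ⟨g, hg⟩ ⟨h, hh⟩ => ⟨g * h, hg.mul hh⟩ }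
  change a ∈ N
  rw [← Finset.univ_sum_single a]
  refine sum_mem fun i _ => ?_
  rcases zmod_two_cases (a i) with h | h
  · rw [h, Pi.single_zero]
    exact zero_mem N
  · rw [h]
    exact ⟨_, HasSupport.basis i⟩

/-- The product of the `z_i`, `a i = 1`, in the order of the list `L`. -/
def monomial (L : List (Fin r ⊕ Fin s)) (a : Fin r ⊕ Fin s → ZMod 2) : (Cl r s)ˣ :=
  (L.map fun i => basisUnit r s i ^ (a i).val).prod

theorem monomial_single_add_of_notMem {L : List (Fin r ⊕ Fin s)} {i : Fin r ⊕ Fin s}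
    (hi : i ∉ L) (a : Fin r ⊕ Fin s → ZMod 2) :
    monomial L (Pi.single i 1 + a) = monomial L a := by
  refine congrArg List.prod (List.map_congr_left fun j hj => ?_)
  have : j ≠ i := fun h => hi (h ▸ hj)
  simp [this]

theorem exists_basisUnit_mul_monomial {L : List (Fin r ⊕ Fin s)} (hL : L.Nodup)
    {i : Fin r ⊕ Fin s} (hi : i ∈ L) (a : Fin r ⊕ Fin s → ZMod 2) :
    ∃ k, basisUnit r s i * monomial L a = sgn k * monomial L (Pi.single i 1 + a) := by
  induction L with
  | nil => simp at hi
  | cons j L ih =>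
    rw [List.nodup_cons] at hL
    have hcons (b : Fin r ⊕ Fin s → ZMod 2) :
        monomial (j :: L) b = basisUnit r s j ^ (b j).val * monomial L b := rfl
    rw [hcons, hcons]
    by_cases hij : i = j
    · subst hij
      rw [monomial_single_add_of_notMem hL.1, ← mul_assoc, Pi.add_apply, Pi.single_eq_same]
      rcases zmod_two_cases (a i) with h | h
      · exact ⟨0, by simp [h, show (1 : ZMod 2).val = 1 from rfl]⟩
      · refine ⟨1 + negInd r s i, ?_⟩
        rw [h, show (1 + 1 : ZMod 2) = 0 from rfl, show (1 : ZMod 2).val = 1 from rfl]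
        simp [basisUnit_mul_self]
    · obtain ⟨k, hk⟩ := ih hL.2 (List.mem_of_ne_of_mem hij hi)
      rw [Pi.add_apply, Pi.single_eq_of_ne (Ne.symm hij), zero_add, ← mul_assoc]
      rcases zmod_two_cases (a j) with h | h
      · exact ⟨k, by simpa [h] using hk⟩
      · refine ⟨1 + k, ?_⟩
        rw [h, show (1 : ZMod 2).val = 1 from rfl, pow_one, basisUnit_anticomm hij, neg_mul,
          mul_assoc, hk, ← mul_assoc, ← sgn_mul_comm, sgn_add, sgn_one, neg_one_mul, neg_mul,
          mul_assoc]

/-- Both elements are compared with one normal form, the monomial in a fixed order of the basis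
vectors. -/
theorem HasSupport.exists_eq_sgn_mul {g h : (Cl r s)ˣ} {a : Fin r ⊕ Fin s → ZMod 2}
    (hg : HasSupport g a) (hh : HasSupport h a) : ∃ k, g = sgn k * h := by
  have key (g : (Cl r s)ˣ) (a : Fin r ⊕ Fin s → ZMod 2) (hg : HasSupport g a) :
      ∃ k, g = sgn k * monomial Finset.univ.toList a := by
    induction hg with
    | one =>
      refine ⟨0, ?_⟩
      simp [monomial]
    | neg _ ih =>
      obtain ⟨k, rfl⟩ := ih
      exact ⟨1 + k, by simp [sgn_add]⟩
    | @basis_mul i g a _ ih =>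
      obtain ⟨k, rfl⟩ := ih
      obtain ⟨m, hm⟩ := exists_basisUnit_mul_monomial (Finset.nodup_toList Finset.univ)
        (Finset.mem_toList.2 (Finset.mem_univ i)) a
      refine ⟨k + m, ?_⟩
      rw [← mul_assoc, ← sgn_mul_comm, mul_assoc, hm, sgn_add, mul_assoc]
  obtain ⟨k, hk⟩ := key g a hg
  obtain ⟨m, hm⟩ := key h a hh
  refine ⟨k + m, ?_⟩
  rw [sgn_add, hm, mul_assoc, ← mul_assoc (sgn m), sgn_mul_self, one_mul, hk]

open CliffordAlgebra (involute involuteEquiv reverse)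

/-! ### Even traces and the dimension of the Clifford algebra -/

theorem HasSupport.involute_eq {g : (Cl r s)ˣ} {a : Fin r ⊕ Fin s → ZMod 2}
    (hg : HasSupport g a) : involute (g : Cl r s) = sgn (∑ i, a i) * (g : Cl r s) := by
  induction hg with
  | one => simp
  | neg _ ih => simp [ih]
  | @basis_mul i g a _ ih =>
    have hi : involute (basisUnit r s i : Cl r s) = -(basisUnit r s i : Cl r s) :=
      CliffordAlgebra.involute_ι _
    have hsum : ∑ j, (Pi.single i 1 + a : Fin r ⊕ Fin s → ZMod 2) j = 1 + ∑ j, a j := by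
      simp [Finset.sum_add_distrib]
    rw [Units.val_mul, map_mul, ih, hi, hsum, sgn_add, sgn_one, ← mul_assoc, ← sgn_mul_comm]
    simp [mul_assoc]

/-- A linear functional that vanishes on commutators and is invariant under the grading. -/
structure IsEvenTrace (t : Cl r s →ₗ[ℝ] ℝ) : Prop where
  mul_comm : ∀ x y, t (x * y) = t (y * x)
  involute : ∀ x, t (involute x) = t x

/-- An odd `g` is negated by the grading. An even `g` with non-empty support is negated by
conjugation with any basis vector in its support. -/
theorem IsEvenTrace.eq_zero {t : Cl r s →ₗ[ℝ] ℝ} (ht : IsEvenTrace t) {g : (Cl r s)ˣ}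
    {a : Fin r ⊕ Fin s → ZMod 2} (hg : HasSupport g a) (ha : a ≠ 0) : t g = 0 := by
  rcases zmod_two_cases (∑ i, a i) with h0 | h1
  · obtain ⟨i, hi⟩ := Function.ne_iff.1 ha
    have hi1 : a i = 1 := (zmod_two_cases (a i)).resolve_left hi
    have hc := hg.basis_comm i
    have hp : polar (Pi.single i 1) a = 1 := by simp [polar, h0, hi1]
    rw [hp, sgn_one, neg_one_mul] at hc
    have hconj : basisUnit r s i * g * (basisUnit r s i)⁻¹ = -g := by
      rw [hc, neg_mul, mul_inv_cancel_right]
    have h := ht.mul_comm ((basisUnit r s i : Cl r s) * g) (((basisUnit r s i)⁻¹ : (Cl r s)ˣ))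
    rw [Units.inv_mul_cancel_left, ← Units.val_mul, ← Units.val_mul, hconj, Units.val_neg,
      map_neg] at h
    linarith
  · have h := ht.involute g
    rw [hg.involute_eq, h1, sgn_one, neg_one_mul, map_neg] at h
    linarith

theorem span_hasSupport :
    Submodule.span ℝ {x : Cl r s | ∃ (g : (Cl r s)ˣ) (a : _), HasSupport g a ∧ x = g} = ⊤ := by
  rw [eq_top_iff]
  rintro x -
  set S : Set (Cl r s) := {x | ∃ (g : (Cl r s)ˣ) (a : _), HasSupport g a ∧ x = g}
  induction x using CliffordAlgebra.induction with
  | algebraMap c =>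
    rw [Algebra.algebraMap_eq_smul_one]
    exact Submodule.smul_mem _ _ (Submodule.subset_span ⟨1, 0, HasSupport.one, by simp⟩)
  | ι v =>
    rw [← Finset.univ_sum_single v, map_sum]
    refine Submodule.sum_mem _ fun i _ => ?_
    have : (Pi.single i (v i) : Fin r ⊕ Fin s → ℝ) = v i • Pi.single i 1 := by
      rw [← Pi.single_smul, smul_eq_mul, mul_one]
    rw [this, map_smul]
    exact Submodule.smul_mem _ _
      (Submodule.subset_span ⟨basisUnit r s i, _, HasSupport.basis i, rfl⟩)
  | mul x y hx hy =>
    have h := Submodule.mul_mem_mul hx hy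
    rw [Submodule.span_mul_span] at h
    refine Submodule.span_mono ?_ h
    rintro _ ⟨_, ⟨g, a, hg, rfl⟩, _, ⟨h, b, hh, rfl⟩, rfl⟩
    exact ⟨g * h, a + b, hg.mul hh, by simp⟩
  | add x y hx hy => exact Submodule.add_mem _ hx hy

theorem span_eq_top_of_hasSupport {g : (Fin r ⊕ Fin s → ZMod 2) → (Cl r s)ˣ}
    (hg : ∀ a, HasSupport (g a) a) :
    Submodule.span ℝ (Set.range fun a => (g a : Cl r s)) = ⊤ := by
  rw [eq_top_iff, ← span_hasSupport, Submodule.span_le]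
  rintro _ ⟨h, a, hh, rfl⟩
  obtain ⟨k, rfl⟩ := hh.exists_eq_sgn_mul (hg a)
  rw [Units.val_mul, coe_sgn, ← sgn_real_smul]
  exact Submodule.smul_mem _ _ (Submodule.subset_span ⟨a, rfl⟩)

instance : FiniteDimensional ℝ (Cl r s) := by
  choose g hg using exists_hasSupport (r := r) (s := s)
  have h := Submodule.fg_span (R := ℝ) (Set.finite_range fun a => (g a : Cl r s))
  rw [span_eq_top_of_hasSupport hg] at h
  exact ⟨h⟩

/-- The trace of the left multiplication. -/
noncomputable def leftTrace (r s : ℕ) : Cl r s →ₗ[ℝ] ℝ :=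
  LinearMap.trace ℝ (Cl r s) ∘ₗ LinearMap.mul ℝ (Cl r s)

/-- The trace of the right multiplication. -/
noncomputable def rightTrace (r s : ℕ) : Cl r s →ₗ[ℝ] ℝ :=
  LinearMap.trace ℝ (Cl r s) ∘ₗ (LinearMap.mul ℝ (Cl r s)).flip

theorem leftTrace_one : leftTrace r s 1 = Module.finrank ℝ (Cl r s) := by
  rw [← LinearMap.trace_one]
  refine congrArg (LinearMap.trace ℝ (Cl r s)) (LinearMap.ext fun x => ?_)
  simp

theorem rightTrace_one : rightTrace r s 1 = Module.finrank ℝ (Cl r s) := by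
  rw [← LinearMap.trace_one]
  refine congrArg (LinearMap.trace ℝ (Cl r s)) (LinearMap.ext fun x => ?_)
  simp

/-- Invariance under the grading holds because an algebra automorphism conjugates multiplication by
`x` into multiplication by its image. -/
theorem isEvenTrace_leftTrace : IsEvenTrace (leftTrace r s) where
  mul_comm x y := by
    have h (x y : Cl r s) : LinearMap.mul ℝ (Cl r s) (x * y) =
        LinearMap.mul ℝ (Cl r s) x * LinearMap.mul ℝ (Cl r s) y :=
      LinearMap.ext fun z => mul_assoc x y z
    simp only [leftTrace, LinearMap.comp_apply, h]
    exact LinearMap.trace_mul_comm ℝ _ _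
  involute x := by
    have h : LinearMap.mul ℝ (Cl r s) (involute x) =
        (involuteEquiv (Q := -(eta r s))).toLinearEquiv.conj (LinearMap.mul ℝ (Cl r s) x) := by
      ext z
      simp [LinearEquiv.conj_apply, involuteEquiv]
    simp only [leftTrace, LinearMap.comp_apply, h]
    exact LinearMap.trace_conj' _ _

theorem isEvenTrace_rightTrace : IsEvenTrace (rightTrace r s) where
  mul_comm x y := by
    have h (x y : Cl r s) : (LinearMap.mul ℝ (Cl r s)).flip (x * y) =
        (LinearMap.mul ℝ (Cl r s)).flip y * (LinearMap.mul ℝ (Cl r s)).flip x :=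
      LinearMap.ext fun z => (mul_assoc z x y).symm
    simp only [rightTrace, LinearMap.comp_apply, h]
    exact LinearMap.trace_mul_comm ℝ _ _
  involute x := by
    have h : (LinearMap.mul ℝ (Cl r s)).flip (involute x) =
        (involuteEquiv (Q := -(eta r s))).toLinearEquiv.conj
          ((LinearMap.mul ℝ (Cl r s)).flip x) := by
      ext z
      simp [LinearEquiv.conj_apply, involuteEquiv]
    simp only [rightTrace, LinearMap.comp_apply, h]
    exact LinearMap.trace_conj' _ _

theorem leftTrace_one_ne_zero : leftTrace r s 1 ≠ 0 := by
  rw [leftTrace_one]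
  exact_mod_cast Module.finrank_pos.ne'

theorem add_eq_zero_iff_zmod_two {ι : Type*} {a b : ι → ZMod 2} : a + b = 0 ↔ a = b := by
  constructor
  · intro h
    ext i
    exact CharTwo.add_eq_zero.1 (congrFun h i)
  · rintro rfl
    ext i
    exact CharTwo.add_self_eq_zero _

/-- Otherwise `1 = g⁻¹ g` would have a non-zero support and trace zero, whereas its trace is the
dimension of the algebra. -/
theorem HasSupport.eq_of_hasSupport {g : (Cl r s)ˣ} {a b : Fin r ⊕ Fin s → ZMod 2}
    (ha : HasSupport g a) (hb : HasSupport g b) : a = b := by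
  by_contra hab
  have h := isEvenTrace_leftTrace.eq_zero (ha.inv.mul hb)
    (fun h => hab (add_eq_zero_iff_zmod_two.1 h))
  rw [inv_mul_cancel, Units.val_one] at h
  exact leftTrace_one_ne_zero h

/-- Multiplying a relation by `(g i)⁻¹` and taking the trace isolates the `i`-th coefficient. -/
theorem linearIndependent_of_hasSupport {κ : Type*} {g : κ → (Cl r s)ˣ}
    {a : κ → Fin r ⊕ Fin s → ZMod 2} (hg : ∀ k, HasSupport (g k) (a k))
    (ha : Function.Injective a) : LinearIndependent ℝ fun k => (g k : Cl r s) := by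
  rw [linearIndependent_iff']
  intro S c hc i hi
  have h := congrArg (fun x => leftTrace r s (((g i)⁻¹ : (Cl r s)ˣ) * x)) hc
  simp only [Finset.mul_sum, map_sum, mul_smul_comm, map_smul, mul_zero, map_zero] at h
  rw [Finset.sum_eq_single i] at h
  · simpa [leftTrace_one_ne_zero] using h
  · intro j _ hj
    rw [← Units.val_mul, isEvenTrace_leftTrace.eq_zero ((hg i).inv.mul (hg j))
      (fun h => hj (ha (add_eq_zero_iff_zmod_two.1 h).symm)), smul_zero]
  · exact fun h => absurd hi h

theorem finrank_cl : Module.finrank ℝ (Cl r s) = 2 ^ (r + s) := by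
  choose g hg using exists_hasSupport (r := r) (s := s)
  have h := Module.finrank_eq_card_basis
    (Module.Basis.mk (linearIndependent_of_hasSupport hg Function.injective_id)
      (span_eq_top_of_hasSupport hg).ge)
  rw [h]
  simp [ZMod.card]

/-- The left trace form is non-degenerate. -/
theorem eq_zero_of_leftTrace_mul {x : Cl r s} (hx : ∀ y, leftTrace r s (y * x) = 0) : x = 0 := by
  choose g hg using exists_hasSupport (r := r) (s := s)
  let b := Module.Basis.mk (linearIndependent_of_hasSupport hg Function.injective_id)
      (span_eq_top_of_hasSupport hg).ge
  have hb (a) : b a = g a := Module.Basis.mk_apply _ _ a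
  refine b.ext_elem fun a => ?_
  rw [map_zero, Finsupp.zero_apply]
  have h := hx ((g a)⁻¹ : (Cl r s)ˣ)
  rw [← b.sum_repr x, Finset.mul_sum, map_sum, Finset.sum_eq_single a] at h
  · simpa [hb, leftTrace_one_ne_zero] using h
  · intro c _ hc
    rw [hb, mul_smul_comm, map_smul, ← Units.val_mul,
      isEvenTrace_leftTrace.eq_zero ((hg a).inv.mul (hg c))
        (fun h => hc (add_eq_zero_iff_zmod_two.1 h).symm), smul_zero]
  · exact fun h => absurd (Finset.mem_univ a) h

theorem IsEvenTrace.eq_of_one_eq {t t' : Cl r s →ₗ[ℝ] ℝ} (ht : IsEvenTrace t)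
    (ht' : IsEvenTrace t') (h1 : t 1 = t' 1) : t = t' := by
  refine LinearMap.ext_on (s := {x : Cl r s | ∃ (g : (Cl r s)ˣ) (a : _), HasSupport g a ∧ x = g})
    span_hasSupport ?_
  rintro _ ⟨g, a, hg, rfl⟩
  by_cases ha : a = 0
  · subst ha
    obtain ⟨k, rfl⟩ := hg.exists_eq_sgn_mul HasSupport.one
    rw [mul_one, coe_sgn, ← mul_one (sgn k : Cl r s), ← sgn_real_smul, map_smul, map_smul, h1]
  · rw [ht.eq_zero hg ha, ht'.eq_zero hg ha]

/-! ### The groups `Pin(r,0)` and `Spin(0,s)` -/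

theorem eta_single (i : Fin r ⊕ Fin s) :
    eta r s (Pi.single i 1) = Sum.elim (fun _ => (1 : ℝ)) (fun _ => (-1 : ℝ)) i := by
  rw [QuadraticMap.weightedSumSquares_apply,
    Finset.sum_eq_single i (fun j _ hj => by simp [hj]) (by simp)]
  cases i <;> simp

/-- The reflection of `ℝ^{r,s}` in `ℝ^{r,0}`. -/
def negReflection (r s : ℕ) : -(eta r s) →qᵢ -(eta r s) where
  toFun x := Sum.elim (fun i => x (Sum.inl i)) (fun j => -x (Sum.inr j))
  map_add' x y := by
    ext (i | i)
    · rfl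
    · simp [add_comm]
  map_smul' c x := by
    ext (i | i) <;> simp
  map_app' x := by
    simp [QuadraticMap.weightedSumSquares_apply, Fintype.sum_sum_type]

theorem negReflection_apply (x : Fin r ⊕ Fin s → ℝ) : negReflection r s x =
    Sum.elim (fun i => x (Sum.inl i)) (fun j => -x (Sum.inr j)) := rfl

theorem map_negReflection_basisUnit (i : Fin r ⊕ Fin s) :
    CliffordAlgebra.map (negReflection r s) (basisUnit r s i : Cl r s) =
      sgn (negInd r s i) * (basisUnit r s i : Cl r s) := by
  refine (CliffordAlgebra.map_apply_ι _ _).trans ?_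
  rw [← sgn_real_smul]
  refine Eq.trans ?_ ((vec r s).map_smul (sgn (negInd r s i)) (Pi.single i 1))
  congr 1
  rw [negReflection_apply]
  ext (j | j) <;> rcases i with i | i <;> simp [negInd, Pi.single_apply, apply_ite]

theorem HasSupport.map_negReflection {g : (Cl r s)ˣ} {a : Fin r ⊕ Fin s → ZMod 2}
    (hg : HasSupport g a) : CliffordAlgebra.map (negReflection r s) (g : Cl r s) =
      sgn (negInd r s ⬝ᵥ a) * (g : Cl r s) := by
  induction hg with
  | one => simp
  | neg _ ih => simp [ih]
  | @basis_mul i g a _ ih =>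
    rw [Units.val_mul, map_mul, ih, map_negReflection_basisUnit, dotProduct_add,
      dotProduct_single_one, sgn_add, mul_assoc, mul_assoc, ← mul_assoc _ _ (g : Cl r s),
      ← sgn_mul_comm, mul_assoc]

theorem map_negReflection_of_mem_pinPos {x : Cl r s} (hx : x ∈ pinPos r s) :
    CliffordAlgebra.map (negReflection r s) x = x := by
  induction hx using Submonoid.closure_induction with
  | one => exact map_one _
  | mul x y _ _ hx hy => rw [map_mul, hx, hy]
  | mem x hx =>
    obtain ⟨v, hv, -, rfl⟩ := hx
    refine (CliffordAlgebra.map_apply_ι _ _).trans (congrArg _ ?_)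
    rw [negReflection_apply]
    ext (j | j) <;> simp [hv]

theorem map_negReflection_of_mem_spinNeg {x : Cl r s} (hx : x ∈ spinNeg r s) :
    CliffordAlgebra.map (negReflection r s) x = x := by
  induction hx using Submonoid.closure_induction with
  | one => exact map_one _
  | mul x y _ _ hx hy => rw [map_mul, hx, hy]
  | mem x hx =>
    obtain ⟨v, w, hv, hw, -, -, rfl⟩ := hx
    have h (v : Fin r ⊕ Fin s → ℝ) (hv : ∀ i : Fin r, v (Sum.inl i) = 0) :
        CliffordAlgebra.map (negReflection r s) (vec r s v) = -vec r s v := by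
      refine (CliffordAlgebra.map_apply_ι _ _).trans ?_
      rw [← map_neg]
      congr 1
      rw [negReflection_apply]
      ext (j | j) <;> simp [hv]
    rw [map_mul, h v hv, h w hw, neg_mul_neg]

/-- The automorphism negating the negative coordinates fixes `Pin(r,0)` and `Spin(0,s)`, but
multiplies `g` by the parity sign of its negative coordinates. -/
theorem HasSupport.negInd_dotProduct_eq_zero {g : (Cl r s)ˣ} {a : Fin r ⊕ Fin s → ZMod 2}
    (hg : HasSupport g a) {x y : Cl r s} (hx : x ∈ pinPos r s) (hy : y ∈ spinNeg r s)
    (hxy : (g : Cl r s) = x * y) : negInd r s ⬝ᵥ a = 0 := by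
  have h := hg.map_negReflection
  nth_rewrite 1 [hxy] at h
  rw [map_mul, map_negReflection_of_mem_pinPos hx, map_negReflection_of_mem_spinNeg hy,
    ← hxy] at h
  refine (zmod_two_cases _).resolve_right fun h1 => ?_
  rw [h1, sgn_one, neg_one_mul, ← Units.val_neg] at h
  have h2 : (-1 : (Cl r s)ˣ) * g = 1 * g := by
    rw [neg_one_mul, one_mul]
    exact (Units.ext h).symm
  exact unit_neg_one_ne_one (mul_right_cancel h2)

theorem exists_mem_pinPos (A : Finset (Fin r)) :
    ∃ u : (Cl r s)ˣ, (u : Cl r s) ∈ pinPos r s ∧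
      HasSupport u (∑ i ∈ A, Pi.single (Sum.inl i) 1) := by
  induction A using Finset.induction_on with
  | empty => exact ⟨1, one_mem _, HasSupport.one⟩
  | insert i A hi ih =>
    obtain ⟨u, hu, hu'⟩ := ih
    refine ⟨basisUnit r s (Sum.inl i) * u, ?_, ?_⟩
    · exact mul_mem (Submonoid.subset_closure
        ⟨_, fun j => by simp, eta_single _, rfl⟩) hu
    · rw [Finset.sum_insert hi]
      exact hu'.basis_mul _

/-- The odd clause strengthens the induction: one further negative basis vector completes the last
pair. -/
theorem exists_mem_spinNeg (B : Finset (Fin s)) :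
    ∃ v : (Cl r s)ˣ, (Even B.card → (v : Cl r s) ∈ spinNeg r s) ∧
      (Odd B.card → ∀ k, (basisUnit r s (Sum.inr k) : Cl r s) * v ∈ spinNeg r s) ∧
      HasSupport v (∑ i ∈ B, Pi.single (Sum.inr i) 1) := by
  induction B using Finset.induction_on with
  | empty => exact ⟨1, fun _ => one_mem _, by simp, HasSupport.one⟩
  | insert i B hi ih =>
    obtain ⟨v, hv, hv', hs⟩ := ih
    refine ⟨basisUnit r s (Sum.inr i) * v, ?_, ?_, ?_⟩
    · rw [Finset.card_insert_of_notMem hi, Nat.even_add_one, Nat.not_even_iff_odd]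
      exact fun h => hv' h i
    · rw [Finset.card_insert_of_notMem hi, Nat.odd_add_one, Nat.not_odd_iff_even]
      intro h k
      rw [Units.val_mul, ← mul_assoc]
      refine mul_mem (Submonoid.subset_closure ⟨_, _, fun j => ?_, fun j => ?_, eta_single _,
        eta_single _, rfl⟩) (hv h) <;> simp
    · rw [Finset.sum_insert hi]
      exact hs.basis_mul _

theorem exists_hasSupport_pinSpin {a : Fin r ⊕ Fin s → ZMod 2} (ha : negInd r s ⬝ᵥ a = 0) :
    ∃ g : (Cl r s)ˣ, HasSupport g a ∧
      ∃ x ∈ pinPos r s, ∃ y ∈ spinNeg r s, (g : Cl r s) = x * y := by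
  obtain ⟨u, hu, hu'⟩ := exists_mem_pinPos (s := s) {i : Fin r | a (Sum.inl i) = 1}
  obtain ⟨v, hv, -, hv'⟩ := exists_mem_spinNeg (r := r) {i : Fin s | a (Sum.inr i) = 1}
  have hsingle (i : Fin r ⊕ Fin s) : (if a i = 1 then Pi.single i 1 else 0) =
      (Pi.single i (a i) : Fin r ⊕ Fin s → ZMod 2) := by
    rcases zmod_two_cases (a i) with h | h <;> simp [h]
  have hval (x : ZMod 2) : (if x = 1 then 1 else 0) = x := by
    rcases zmod_two_cases x with h | h <;> simp [h]
  refine ⟨u * v, ?_, u, hu, v, hv ?_, rfl⟩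
  · have := hu'.mul hv'
    simp only [Finset.sum_filter, hsingle] at this
    rwa [← Fintype.sum_sum_type (fun i => (Pi.single i (a i) : Fin r ⊕ Fin s → ZMod 2)),
      Finset.univ_sum_single] at this
  · rw [← ZMod.natCast_eq_zero_iff_even, Finset.card_eq_sum_ones, Nat.cast_sum,
      Finset.sum_filter]
    simpa [dotProduct, negInd, Fintype.sum_sum_type, hval] using ha

/-! ### Sets of positive involutions and codes -/

section Involutions

variable {l : ℕ} {p : Fin l → (Cl r s)ˣ}

theorem pairwise_commute (hp : ∀ i j, p i * p j = p j * p i) (T : Finset (Fin l)) :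
    (T : Set (Fin l)).Pairwise (Function.onFun Commute p) := fun i _ j _ _ => hp i j

theorem orderedProd_eq_noncommProd (hp : ∀ i j, p i * p j = p j * p i) (T : Finset (Fin l)) :
    orderedProd p T = T.noncommProd p (pairwise_commute hp T) := by
  rw [orderedProd, ← Finset.noncommProd_toFinset (T.sort (· ≤ ·)) p (pairwise_commute hp _)
    (T.sort_nodup _)]
  exact Finset.noncommProd_congr (T.sort_toFinset _) (fun _ _ => rfl) _

theorem orderedProd_mul_self (hp : ∀ i j, p i * p j = p j * p i) (hsq : ∀ i, p i ^ 2 = 1)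
    (T : Finset (Fin l)) : orderedProd p T * orderedProd p T = 1 := by
  have h (L : List (Fin l)) : (L.map p).prod * (L.map p).prod = 1 := by
    induction L with
    | nil => simp
    | cons i L ih =>
      have hc : Commute (p i) (L.map p).prod := Commute.list_prod_right _ _ fun x hx => by
        obtain ⟨j, -, rfl⟩ := List.mem_map.1 hx
        exact hp i j
      rw [List.map_cons, List.prod_cons, hc.symm.mul_mul_mul_comm, ih, ← sq, hsq, one_mul]
  exact h _

theorem exists_mul_orderedProd (hp : ∀ i j, p i * p j = p j * p i) (hsq : ∀ i, p i ^ 2 = 1)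
    (i : Fin l) (T : Finset (Fin l)) : ∃ U, p i * orderedProd p T = orderedProd p U := by
  simp only [orderedProd_eq_noncommProd hp]
  by_cases hi : i ∈ T
  · refine ⟨T.erase i, ?_⟩
    rw [← Finset.mul_noncommProd_erase T hi p (pairwise_commute hp T), ← mul_assoc, ← sq, hsq, one_mul]
  · exact ⟨insert i T, (Finset.noncommProd_insert_of_notMem T i p _ hi).symm⟩

theorem mem_closure_iff_orderedProd (hp : ∀ i j, p i * p j = p j * p i)
    (hsq : ∀ i, p i ^ 2 = 1) {g : (Cl r s)ˣ} :
    g ∈ Subgroup.closure (Set.range p) ↔ ∃ T, orderedProd p T = g := by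
  constructor
  · intro hg
    induction hg using Subgroup.closure_induction_left with
    | one => exact ⟨∅, by simp [orderedProd]⟩
    | mul_left x hx y _ ih =>
      obtain ⟨i, rfl⟩ := hx
      obtain ⟨T, rfl⟩ := ih
      obtain ⟨U, hU⟩ := exists_mul_orderedProd hp hsq i T
      exact ⟨U, hU.symm⟩
    | inv_mul_cancel x hx y _ ih =>
      obtain ⟨i, rfl⟩ := hx
      obtain ⟨T, rfl⟩ := ih
      obtain ⟨U, hU⟩ := exists_mul_orderedProd hp hsq i T
      refine ⟨U, ?_⟩
      rw [← hU, mul_right_cancel_iff, eq_inv_iff_mul_eq_one, ← sq, hsq]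
  · rintro ⟨T, rfl⟩
    refine list_prod_mem fun x hx => ?_
    obtain ⟨i, -, rfl⟩ := List.mem_map.1 hx
    exact Subgroup.subset_closure ⟨i, rfl⟩

theorem IsPI.card_closure (hp : IsPI r s p) :
    Nat.card (Subgroup.closure (Set.range p)) = 2 ^ l := by
  have hinj : Function.Injective (orderedProd p) := fun T U h =>
    hp.linInd.injective (congrArg Units.val h)
  have hset : (Subgroup.closure (Set.range p) : Set (Cl r s)ˣ) = Set.range (orderedProd p) := by
    ext g
    exact mem_closure_iff_orderedProd hp.comm hp.sq
  have h : Nat.card (Subgroup.closure (Set.range p)) = Nat.card (Set.range (orderedProd p)) :=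
    congrArg (fun S : Set (Cl r s)ˣ => Nat.card S) hset
  rw [h, ← Nat.card_congr (Equiv.ofInjective _ hinj)]
  simp

/-- A product `±1` is proportional to the empty product, against linear independence. In particular
`-1` is not in `S(PI)`. -/
theorem IsPI.eq_empty_of_orderedProd_eq_sgn (hp : IsPI r s p) {T : Finset (Fin l)} {k : ZMod 2}
    (h : orderedProd p T = sgn k) : T = ∅ := by
  have hempty : orderedProd p ∅ = 1 := by simp [orderedProd]
  have h1 : (1 : ℝ) • (orderedProd p T : Cl r s) = (sgn k : ℝ) • (orderedProd p ∅ : Cl r s) := by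
    rw [one_smul, sgn_real_smul, hempty, h, coe_sgn, Units.val_one, mul_one]
  exact hp.linInd.eq_of_smul_apply_eq_smul_apply _ _ _ _ one_ne_zero h1

theorem hasSupport_orderedProd {a : Fin l → Fin r ⊕ Fin s → ZMod 2}
    (hp : ∀ i, HasSupport (p i) (a i)) (T : Finset (Fin l)) :
    HasSupport (orderedProd p T) (∑ i ∈ T, a i) := by
  have h (L : List (Fin l)) : HasSupport (L.map p).prod (L.map a).sum := by
    induction L with
    | nil => exact HasSupport.one
    | cons i L ih =>
      rw [List.map_cons, List.prod_cons, List.map_cons, List.sum_cons]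
      exact (hp i).mul ih
  have h' : ∑ i ∈ T, a i = ((T.sort (· ≤ ·)).map a).sum := by
    rw [Finset.sum, ← Finset.sort_eq T (· ≤ ·), Multiset.map_coe, Multiset.sum_coe]
  rw [h']
  exact h _

theorem sum_smul_eq_sum_filter {X : Type*} [AddCommGroup X] [Module (ZMod 2) X]
    (c : Fin l → ZMod 2) (a : Fin l → X) :
    ∑ i, c i • a i = ∑ i with c i = 1, a i := by
  rw [Finset.sum_filter]
  refine Finset.sum_congr rfl fun i _ => ?_
  rcases zmod_two_cases (c i) with h | h <;> simp [h]

/-- The code is spanned by the supports. It is good since products of commuting involutions square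
to one; a relation among supports would make a non-empty product equal to `±1`. -/
theorem mem_codeDims_of_isPI (hp : IsPI r s p) : l ∈ codeDims (negInd r s) := by
  choose a ha using fun i => exists_hasSupport_of_mem (hp.mem i)
  refine ⟨Submodule.span (ZMod 2) (Set.range a), ?_, ?_⟩
  · intro c hc
    obtain ⟨k, rfl⟩ := (Submodule.mem_span_range_iff_exists_fun _).1 hc
    rw [sum_smul_eq_sum_filter]
    have hT := hasSupport_orderedProd ha {i | k i = 1}
    have hν : negInd r s ⬝ᵥ ∑ i with k i = 1, a i = 0 := by
      rw [dotProduct_sum]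
      refine Finset.sum_eq_zero fun i _ => ?_
      obtain ⟨x, hx, y, hy, hxy⟩ := hp.pinSpin i
      exact (ha i).negInd_dotProduct_eq_zero hx hy hxy
    refine ⟨?_, hν⟩
    have hq := hT.mul_self
    rw [orderedProd_mul_self hp.comm hp.sq, quad, hν, add_zero] at hq
    refine (zmod_two_cases _).resolve_right fun h1 => ?_
    rw [h1, sgn_one] at hq
    exact unit_neg_one_ne_one hq.symm
  · rw [finrank_span_eq_card, Fintype.card_fin]
    rw [Fintype.linearIndependent_iff]
    intro c hc i
    rw [sum_smul_eq_sum_filter] at hc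
    have hT := hasSupport_orderedProd ha {i | c i = 1}
    rw [hc] at hT
    obtain ⟨k, hk⟩ := hT.exists_eq_sgn_mul HasSupport.one
    rw [mul_one] at hk
    have hT0 := hp.eq_empty_of_orderedProd_eq_sgn hk
    refine (zmod_two_cases _).resolve_right fun h => ?_
    exact Finset.notMem_empty i (hT0 ▸ Finset.mem_filter.2 ⟨Finset.mem_univ i, h⟩)

theorem exists_isPI_of_mem_codeDims (hl : l ∈ codeDims (negInd r s)) :
    ∃ p : Fin l → (Cl r s)ˣ, IsPI r s p := by
  obtain ⟨C, hC, rfl⟩ := hl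
  let b := Module.finBasis (ZMod 2) C
  choose p hp hpin using fun i => exists_hasSupport_pinSpin (hC _ (b i).2).2
  have hli : LinearIndependent (ZMod 2) fun i => (b i : Fin r ⊕ Fin s → ZMod 2) :=
    b.linearIndependent.map' C.subtype C.ker_subtype
  refine ⟨p, ⟨fun i => (hp i).mem_basisGroup, fun i h => ?_, fun i j => ?_, hpin, fun i => ?_, ?_⟩⟩
  · have h0 := hp i
    rw [h] at h0
    exact hli.ne_zero i (h0.eq_of_hasSupport HasSupport.one)
  · rw [(hp i).comm (hp j), hC.polar_eq_zero (b i).2 (b j).2, sgn_zero, one_mul]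
  · rw [sq, (hp i).mul_self, hC.quad_eq_zero (b i).2, sgn_zero]
  · refine linearIndependent_of_hasSupport (fun T => hasSupport_orderedProd hp T) ?_
    intro T U hTU
    have hind (T : Finset (Fin (Module.finrank (ZMod 2) C))) :
        ∑ i ∈ T, (b i : Fin r ⊕ Fin s → ZMod 2) =
          ∑ i, (if i ∈ T then (1 : ZMod 2) else 0) • (b i : Fin r ⊕ Fin s → ZMod 2) := by
      simp [Finset.sum_ite_mem]
    simp only [hind] at hTU
    have h := Fintype.linearIndependent_iffₛ.1 hli _ _ hTU
    ext i
    have hi := h i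
    by_cases h1 : i ∈ T <;> by_cases h2 : i ∈ U <;> simp_all

end Involutions

theorem piCards_eq_codeDims (r s : ℕ) : piCards r s = codeDims (negInd r s) :=
  Set.Subset.antisymm (fun _ ⟨_, hp⟩ => mem_codeDims_of_isPI hp)
    fun _ hl => exists_isPI_of_mem_codeDims hl

/-! ### A lower bound for the dimension of an admissible module -/

section LowerBound

variable {V : Type} [AddCommGroup V] [Module ℝ V] {J : Cl r s →ₐ[ℝ] Module.End ℝ V}
  {B : LinearMap.BilinForm ℝ V}

theorem apply_mul (x y : Cl r s) (u : V) : J (x * y) u = J x (J y u) := by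
  rw [map_mul, Module.End.mul_apply]

theorem apply_sgn_mul (k : ZMod 2) (x : Cl r s) (u : V) :
    J (sgn k * x) u = (sgn k : ℝ) • J x u := by
  rw [← sgn_real_smul, map_smul, LinearMap.smul_apply]

/-- By skewness a positive basis vector acts as an isometry and a negative one as an anti-isometry.
-/
theorem IsAdmissible.apply_apply (hJ : IsAdmissible J B) {g : (Cl r s)ˣ}
    {a : Fin r ⊕ Fin s → ZMod 2} (hg : HasSupport g a) (u v : V) :
    B (J g u) (J g v) = sgn (negInd r s ⬝ᵥ a) * B u v := by
  induction hg with
  | one => simp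
  | neg _ ih => simpa using ih
  | @basis_mul i g a _ ih =>
    have hi (u v : V) : B (J (basisUnit r s i) u) (J (basisUnit r s i) v) =
        sgn (negInd r s i) * B u v := by
      have h1 := hJ.skew (Pi.single i 1) u (J (basisUnit r s i) v)
      change B (J (basisUnit r s i) u) (J (basisUnit r s i) v) +
        B u (J (basisUnit r s i) (J (basisUnit r s i) v)) = 0 at h1
      rw [← apply_mul, ← Units.val_mul, basisUnit_mul_self, coe_sgn,
        ← mul_one (sgn (1 + negInd r s i) : Cl r s), apply_sgn_mul, map_one,
        Module.End.one_apply, map_smul, sgn_add, sgn_one, smul_eq_mul] at h1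
      linarith
    rw [Units.val_mul, apply_mul, apply_mul, hi, ih, dotProduct_add, dotProduct_single_one,
      sgn_add, mul_assoc]

/-- Non-isotropic common eigenvectors of the elements with support in a good code. -/
theorem IsAdmissible.exists_eigenvector_list [Nontrivial V] (hJ : IsAdmissible J B)
    {C : Submodule (ZMod 2) (Fin r ⊕ Fin s → ZMod 2)} (hC : IsGood (negInd r s) C)
    (L : List (Cl r s)ˣ) (hL : ∀ h ∈ L, ∃ c ∈ C, HasSupport h c) :
    ∃ u, B u u ≠ 0 ∧ ∀ h ∈ L, ∃ k, J (h : Cl r s) u = (sgn k : ℝ) • u := by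
  induction L with
  | nil =>
    obtain ⟨u, hu⟩ := LinearMap.BilinForm.exists_bilinForm_self_ne_zero hJ.nondeg.ne_zero
      ⟨fun u v => hJ.symm u v⟩
    exact ⟨u, hu, by simp⟩
  | cons h L ih =>
    obtain ⟨u, hu, hL'⟩ := ih fun h' hh' => hL h' (List.mem_cons_of_mem _ hh')
    obtain ⟨c, hc, hhc⟩ := hL h List.mem_cons_self
    have hhh : J (h : Cl r s) (J (h : Cl r s) u) = u := by
      rw [← apply_mul, ← Units.val_mul, hhc.mul_self, hC.quad_eq_zero hc]
      simp
    have hiso : B (J h u) (J h u) = B u u := by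
      rw [hJ.apply_apply hhc, (hC c hc).2, sgn_zero, one_mul]
    -- Parallelogram law for the isometric involution `h`: one of its eigenvectors `u ± h u` is
    -- non-isotropic.
    have hsum : B (u + J h u) (u + J h u) + B (u - J h u) (u - J h u) = 4 * B u u := by
      simp only [map_add, map_sub, LinearMap.add_apply, LinearMap.sub_apply, hiso]
      ring
    obtain ⟨k, hk⟩ : ∃ k : ZMod 2,
        B (u + (sgn k : ℝ) • J h u) (u + (sgn k : ℝ) • J h u) ≠ 0 := by
      by_contra! hcon
      have h0 := hcon 0
      have h1 := hcon 1
      simp only [sgn_zero, sgn_one, one_smul, neg_smul, ← sub_eq_add_neg] at h0 h1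
      rw [h0, h1, add_zero] at hsum
      exact hu (by linarith)
    refine ⟨_, hk, fun h' hh' => ?_⟩
    rcases List.mem_cons.1 hh' with rfl | hh'
    · refine ⟨k, ?_⟩
      rw [map_add, map_smul, hhh, smul_add, smul_smul, sgn_mul_self, one_smul, add_comm]
    · obtain ⟨m, hm⟩ := hL' h' hh'
      obtain ⟨c', hc', hhc'⟩ := hL h' (List.mem_cons_of_mem _ hh')
      refine ⟨m, ?_⟩
      have hcomm : h' * h = h * h' := by
        rw [hhc'.comm hhc, hC.polar_eq_zero hc' hc, sgn_zero, one_mul]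
      rw [map_add, map_smul, ← apply_mul, ← Units.val_mul, hcomm, Units.val_mul, apply_mul, hm,
        map_smul, smul_add, smul_comm]

theorem IsAdmissible.exists_eigenvector [Nontrivial V] (hJ : IsAdmissible J B)
    {C : Submodule (ZMod 2) (Fin r ⊕ Fin s → ZMod 2)} (hC : IsGood (negInd r s) C) :
    ∃ u, B u u ≠ 0 ∧ ∀ c ∈ C, ∃ h : (Cl r s)ˣ, HasSupport h c ∧
      ∃ k, J (h : Cl r s) u = (sgn k : ℝ) • u := by
  choose f hf using exists_hasSupport (r := r) (s := s)
  obtain ⟨u, hu, hL⟩ := hJ.exists_eigenvector_list hC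
    (((C : Set (Fin r ⊕ Fin s → ZMod 2)).toFinite.toFinset.toList).map f) (by
      intro h hh
      obtain ⟨c, hc, rfl⟩ := List.mem_map.1 hh
      exact ⟨c, by simpa using hc, hf c⟩)
  exact ⟨u, hu, fun c hc => ⟨f c, hf c, hL _ (List.mem_map_of_mem (by simpa using hc))⟩⟩

/-- Here `g` acts isometrically. If `g² = -1`, it is skew. If `g² = 1`, maximality of `C` provides
an isometry `h` with support in `C` that anticommutes with `g`; since `h u = ± u`, applying `h` to
both arguments negates `B (g u) u`. -/
theorem IsAdmissible.apply_self_eq_zero (hJ : IsAdmissible J B)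
    {C : Submodule (ZMod 2) (Fin r ⊕ Fin s → ZMod 2)} (hC : IsGood (negInd r s) C)
    (hmax : IsGreatest (codeDims (negInd r s)) (Module.finrank (ZMod 2) C)) {u : V}
    (hu : ∀ c ∈ C, ∃ h : (Cl r s)ˣ, HasSupport h c ∧ ∃ k, J (h : Cl r s) u = (sgn k : ℝ) • u)
    {g : (Cl r s)ˣ} {a : Fin r ⊕ Fin s → ZMod 2} (hg : HasSupport g a)
    (hν : negInd r s ⬝ᵥ a = 0) (ha : a ∉ C) : B (J g u) u = 0 := by
  rcases zmod_two_cases (quad (negInd r s) a) with hq | hq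
  · obtain ⟨c, hc, hp⟩ : ∃ c ∈ C, polar a c = 1 := by
      by_contra! hcon
      exact ha (hC.mem_of_isGreatest hmax hq hν fun c hc =>
        (zmod_two_cases _).resolve_right (hcon c hc))
    obtain ⟨h, hh, k, hk⟩ := hu c hc
    have h1 := hJ.apply_apply hh (J g u) u
    have hgh := hg.comm hh
    rw [hp, sgn_one, neg_one_mul] at hgh
    rw [← apply_mul, ← Units.val_mul, show h * g = -(g * h) by rw [hgh, neg_neg], Units.val_neg,
      map_neg, LinearMap.neg_apply, Units.val_mul, apply_mul, hk, (hC c hc).2, sgn_zero,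
      one_mul] at h1
    simp only [map_smul, map_neg, LinearMap.neg_apply, LinearMap.smul_apply, smul_eq_mul] at h1
    have h2 : (sgn k * sgn k : ℝ) = 1 := sgn_mul_self k
    have h3 : -(sgn k * sgn k : ℝ) * B (J g u) u = B (J g u) u := by
      linarith
    rw [h2] at h3
    linarith
  · have h1 := hJ.apply_apply hg (J g u) u
    rw [← apply_mul, ← Units.val_mul, hg.mul_self, hq, hν, sgn_one, sgn_zero, one_mul,
      Units.val_neg, map_neg, Units.val_one, map_one, LinearMap.neg_apply,
      Module.End.one_apply, map_neg, LinearMap.neg_apply, hJ.symm u] at h1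
    linarith

theorem IsAdmissible.two_pow_le_finrank_mul [Nontrivial V] [FiniteDimensional ℝ V]
    (hJ : IsAdmissible J B)
    {C : Submodule (ZMod 2) (Fin r ⊕ Fin s → ZMod 2)} (hC : IsGood (negInd r s) C)
    (hmax : IsGreatest (codeDims (negInd r s)) (Module.finrank (ZMod 2) C)) :
    2 ^ (r + s) ≤ 2 ^ Module.finrank (ZMod 2) C * Module.finrank ℝ V := by
  obtain ⟨u, hu, heig⟩ := hJ.exists_eigenvector hC
  have hzero := fun g a => hJ.apply_self_eq_zero hC hmax heig (g := g) (a := a)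
  let Q := (Fin r ⊕ Fin s → ZMod 2) ⧸ C
  let a : Q → Fin r ⊕ Fin s → ZMod 2 := Quotient.out
  have ha {j k : Q} (h : a j + a k ∈ C) : j = k := by
    have h' : -a j + a k ∈ C := by
      rwa [show -a j = a j from funext fun i => CharTwo.neg_eq (a j i)]
    have := (QuotientAddGroup.eq (s := C.toAddSubgroup)).2 h'
    rwa [show ((a j : _ ⧸ C.toAddSubgroup)) = j from Quotient.out_eq j,
      show ((a k : _ ⧸ C.toAddSubgroup)) = k from Quotient.out_eq k] at this
  choose g hg using fun j => exists_hasSupport (a j)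
  -- Up to sign this is `B (g_k⁻¹ g_j u) u`, and `g_k⁻¹ g_j` has support outside `C` and evenly many
  -- negative coordinates.
  have horth {j k : Q} (hjk : j ≠ k) (hν : negInd r s ⬝ᵥ a j = negInd r s ⬝ᵥ a k) :
      B (J (g j) u) (J (g k) u) = 0 := by
    have hs := (hg k).inv.mul (hg j)
    have h1 := hJ.apply_apply (hg k) (J ((g k)⁻¹ * g j : (Cl r s)ˣ) u) u
    rw [← apply_mul, ← Units.val_mul, mul_inv_cancel_left, hzero _ _ hs, mul_zero] at h1
    · exact h1
    · rw [dotProduct_add, hν]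
      exact CharTwo.add_self_eq_zero _
    · exact fun h => hjk (ha h).symm
  have : Fintype Q := Fintype.ofFinite Q
  have hli : LinearIndependent ℝ fun j : Q => J (g j : Cl r s) u := by
    rw [Fintype.linearIndependent_iff]
    intro c hc
    -- Translates of different parity need not be orthogonal, but `B` is definite with opposite
    -- signs on the two families. As `x 0 = -x 1`, both squares vanish.
    let x (ε : ZMod 2) : V := ∑ j with negInd r s ⬝ᵥ a j = ε, c j • J (g j : Cl r s) u
    have hx (ε : ZMod 2) : B (x ε) (x ε) =
        sgn ε * B u u * ∑ j with negInd r s ⬝ᵥ a j = ε, c j ^ 2 := by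
      simp only [x, map_sum, LinearMap.sum_apply, map_smul, LinearMap.smul_apply, smul_eq_mul]
      rw [Finset.mul_sum]
      refine Finset.sum_congr rfl fun j hj => ?_
      rw [Finset.mem_filter] at hj
      rw [Finset.sum_eq_single j]
      · rw [hJ.apply_apply (hg j), hj.2]
        ring
      · intro k hk hkj
        rw [Finset.mem_filter] at hk
        rw [horth hkj (by rw [hk.2, hj.2]), mul_zero]
      · intro h
        exact absurd (Finset.mem_filter.2 hj) h
    have hfilter : (Finset.univ.filter fun j => ¬negInd r s ⬝ᵥ a j = 0) =
        Finset.univ.filter fun j => negInd r s ⬝ᵥ a j = 1 := by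
      refine Finset.filter_congr fun j _ => ?_
      rcases zmod_two_cases (negInd r s ⬝ᵥ a j) with h | h <;> simp [h]
    have hsum : x 0 + x 1 = 0 := by
      rw [← hc, ← Finset.sum_filter_add_sum_filter_not Finset.univ
        (fun j => negInd r s ⬝ᵥ a j = 0), hfilter]
    have h01 : B (x 0) (x 0) = B (x 1) (x 1) := by
      rw [eq_neg_of_add_eq_zero_left hsum]
      simp
    rw [hx, hx, sgn_zero, sgn_one] at h01
    have hsq : ∑ j, c j ^ 2 = 0 := by
      rw [← Finset.sum_filter_add_sum_filter_not Finset.univ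
        (fun j => negInd r s ⬝ᵥ a j = 0), hfilter]
      refine (mul_eq_zero.1 (?_ : B u u * _ = 0)).resolve_left hu
      linarith
    intro j
    have := (Finset.sum_eq_zero_iff_of_nonneg fun j _ => sq_nonneg (c j)).1 hsq j
      (Finset.mem_univ j)
    exact pow_eq_zero_iff two_ne_zero |>.1 this
  have hcard := hli.fintype_card_le_finrank
  have h2 := Submodule.card_eq_card_quotient_mul_card C
  rw [Module.natCard_eq_pow_finrank (K := ZMod 2) (V := C), Nat.card_zmod] at h2
  have h3 : Nat.card (Fin r ⊕ Fin s → ZMod 2) = 2 ^ (r + s) := by simp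
  rw [← h3, h2]
  refine Nat.mul_le_mul_left _ ?_
  rwa [Nat.card_eq_fintype_card]

end LowerBound

/-! ### The admissible module of a set of positive involutions -/

/-- The anti-automorphism of `Cl_{r,s}` that is `-1` on `ℝ^{r,s}`. -/
def conj (r s : ℕ) : Cl r s →ₗ[ℝ] Cl r s := reverse ∘ₗ (involute (Q := -(eta r s))).toLinearMap

theorem conj_mul (x y : Cl r s) : conj r s (x * y) = conj r s y * conj r s x := by
  simp [conj, CliffordAlgebra.reverse.map_mul]

theorem conj_one : conj r s 1 = 1 := by
  simp [conj, CliffordAlgebra.reverse.map_one]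

theorem conj_vec (v : Fin r ⊕ Fin s → ℝ) : conj r s (vec r s v) = -vec r s v := by
  simp [conj]

theorem conj_conj (x : Cl r s) : conj r s (conj r s x) = x := by
  simp [conj, CliffordAlgebra.reverse_involute]

theorem conj_involute (x : Cl r s) : conj r s (involute x) = involute (conj r s x) := by
  simp [conj, CliffordAlgebra.reverse_involute]

theorem HasSupport.conj_mul_self {g : (Cl r s)ˣ} {a : Fin r ⊕ Fin s → ZMod 2}
    (hg : HasSupport g a) : conj r s g * g = sgn (negInd r s ⬝ᵥ a) := by
  induction hg with
  | one => simp [conj_one]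
  | neg _ ih => simpa using ih
  | @basis_mul i g a _ ih =>
    have hi : conj r s (basisUnit r s i) * (basisUnit r s i : Cl r s) = sgn (negInd r s i) := by
      have h1 : conj r s (basisUnit r s i) = -(basisUnit r s i : Cl r s) := conj_vec _
      rw [h1, neg_mul, ← Units.val_mul, basisUnit_mul_self, coe_sgn, sgn_add, sgn_one,
        neg_one_mul, neg_neg]
    rw [Units.val_mul, conj_mul, mul_assoc, ← mul_assoc (conj r s (basisUnit r s i)), hi,
      ← mul_assoc, ← sgn_mul_comm, mul_assoc, ih, dotProduct_add, dotProduct_single_one, sgn_add]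

/-- An even trace is determined by its value at one; this yields the symmetry of `conjForm`. -/
theorem leftTrace_conj (x : Cl r s) : leftTrace r s (conj r s x) = leftTrace r s x := by
  have h : IsEvenTrace (leftTrace r s ∘ₗ conj r s) :=
    { mul_comm := fun x y => by
        simp only [LinearMap.comp_apply, conj_mul]
        exact isEvenTrace_leftTrace.mul_comm _ _
      involute := fun x => by
        simp only [LinearMap.comp_apply, conj_involute]
        exact isEvenTrace_leftTrace.involute _ }
  exact LinearMap.congr_fun (h.eq_of_one_eq isEvenTrace_leftTrace (by simp [conj_one])) x

/-- The bilinear form `(x, y) ↦ tr (x̄ y)` on a left ideal. -/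
noncomputable def conjForm (I : Submodule (Cl r s) (Cl r s)) : LinearMap.BilinForm ℝ I :=
  LinearMap.mk₂ ℝ (fun x y => leftTrace r s (conj r s x.1 * y.1))
    (fun x y z => by simp [add_mul]) (fun c x y => by simp)
    (fun x y z => by simp [mul_add]) (fun c x y => by simp)

theorem conjForm_apply (I : Submodule (Cl r s) (Cl r s)) (x y : I) :
    conjForm I x y = leftTrace r s (conj r s x.1 * y.1) := rfl

theorem conjForm_symm (I : Submodule (Cl r s) (Cl r s)) (x y : I) :
    conjForm I x y = conjForm I y x := by
  rw [conjForm_apply, conjForm_apply, ← leftTrace_conj, conj_mul, conj_conj]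

/-- The left ideal generated by a self-conjugate idempotent is an admissible module. -/
theorem isAdmissible_conjForm {e : Cl r s} (he : e * e = e) (hconj : conj r s e = e) :
    IsAdmissible (r := r) (s := s) (Algebra.lsmul ℝ ℝ (Submodule.span (Cl r s) {e}))
      (conjForm (Submodule.span (Cl r s) {e})) := by
  set I := Submodule.span (Cl r s) {e}
  have hI {x : Cl r s} (hx : x ∈ I) : x * e = x := by
    obtain ⟨y, rfl⟩ := Submodule.mem_span_singleton.1 hx
    rw [smul_eq_mul, mul_assoc, he]
  -- Testing against `w̄ e` gives `tr (e w y) = tr (w y e) = tr (w y)`, so non-degeneracy descends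
  -- from the whole algebra.
  have hsep (y : I) (hy : ∀ x, conjForm I x y = 0) : y = 0 := by
    refine Subtype.ext (eq_zero_of_leftTrace_mul fun w => ?_)
    have h := hy ⟨conj r s w * e, Submodule.mem_span_singleton.2 ⟨conj r s w, rfl⟩⟩
    rwa [conjForm_apply, conj_mul, conj_conj, hconj, mul_assoc,
      isEvenTrace_leftTrace.mul_comm, mul_assoc, hI y.2] at h
  refine ⟨conjForm_symm I, ⟨fun x hx => hsep x fun y => ?_, hsep⟩, fun z u v => ?_⟩
  · rw [conjForm_symm]
    exact hx y
  · rw [conjForm_apply, conjForm_apply]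
    change leftTrace r s (conj r s (vec r s z * u.1) * v.1) +
      leftTrace r s (conj r s u.1 * (vec r s z * v.1)) = 0
    rw [conj_mul, conj_vec, mul_assoc, neg_mul, mul_neg, map_neg, neg_add_cancel]

/-- Right multiplication by `e` projects onto `Cl e`, and the trace of a projection is its rank. -/
theorem finrank_span_singleton_idempotent {e : Cl r s} (he : e * e = e) :
    (Module.finrank ℝ (Submodule.span (Cl r s) {e}) : ℝ) = rightTrace r s e := by
  have h : LinearMap.IsProj ((Submodule.span (Cl r s) {e}).restrictScalars ℝ)
      ((LinearMap.mul ℝ (Cl r s)).flip e) := by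
    refine ⟨fun x => Submodule.mem_span_singleton.2 ⟨x, rfl⟩, fun x hx => ?_⟩
    obtain ⟨y, rfl⟩ := Submodule.mem_span_singleton.1 hx
    rw [LinearMap.flip_apply, LinearMap.mul_apply', smul_eq_mul, mul_assoc, he]
  exact h.trace.symm

theorem IsPI.exists_idempotent {l : ℕ} {p : Fin l → (Cl r s)ˣ} (hp : IsPI r s p) :
    ∃ e : Cl r s, e * e = e ∧ conj r s e = e ∧ 2 ^ l * rightTrace r s e = 2 ^ (r + s) := by
  have hcard := hp.card_closure
  set S := Subgroup.closure (Set.range p)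
  have : Finite S := Nat.finite_of_card_ne_zero (by rw [hcard]; positivity)
  have : Fintype S := Fintype.ofFinite S
  rw [Nat.card_eq_fintype_card] at hcard
  have h2 : (2 : ℝ) ^ l ≠ 0 := by positivity
  choose a ha using fun i => exists_hasSupport_of_mem (hp.mem i)
  have hν (i : Fin l) : negInd r s ⬝ᵥ a i = 0 := by
    obtain ⟨x, hx, y, hy, hxy⟩ := hp.pinSpin i
    exact (ha i).negInd_dotProduct_eq_zero hx hy hxy
  -- The idempotent is `σ / 2^l`. Elements of `S` are self-conjugate, because `ḡ g = 1 = g²`, and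
  -- only the identity contributes to the trace of `σ`.
  let σ : Cl r s := ∑ g : S, ((g : (Cl r s)ˣ) : Cl r s)
  have hmul (g : S) : ((g : (Cl r s)ˣ) : Cl r s) * σ = σ := by
    rw [Finset.mul_sum]
    exact Fintype.sum_equiv (Equiv.mulLeft g) _ _ fun h => by simp
  have hσ : σ * σ = (2 ^ l : ℝ) • σ := by
    conv_lhs => rw [show σ * σ = ∑ g : S, ((g : (Cl r s)ˣ) : Cl r s) * σ from Finset.sum_mul _ _ _]
    simp only [hmul, Finset.sum_const, Finset.card_univ, hcard]
    rw [← Nat.cast_smul_eq_nsmul ℝ]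
    push_cast
    rfl
  have hconj : conj r s σ = σ := by
    simp only [σ, map_sum]
    refine Finset.sum_congr rfl fun g _ => ?_
    obtain ⟨T, hT⟩ := (mem_closure_iff_orderedProd hp.comm hp.sq).1 g.2
    have h1 := (hasSupport_orderedProd ha T).conj_mul_self
    rw [dotProduct_sum, Finset.sum_eq_zero fun i _ => hν i, sgn_zero] at h1
    have h3 := congrArg (· * (orderedProd p T : Cl r s)) h1
    simp only [mul_assoc, one_mul] at h3
    rw [← Units.val_mul, orderedProd_mul_self hp.comm hp.sq, Units.val_one, mul_one] at h3
    rw [← hT, h3]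
  have htrace : rightTrace r s σ = 2 ^ (r + s) := by
    simp only [σ, map_sum]
    rw [Finset.sum_eq_single 1]
    · rw [Subgroup.coe_one, Units.val_one, rightTrace_one, finrank_cl]
      push_cast
      rfl
    · intro g _ hg
      obtain ⟨T, hT⟩ := (mem_closure_iff_orderedProd hp.comm hp.sq).1 g.2
      rw [← hT]
      refine isEvenTrace_rightTrace.eq_zero (hasSupport_orderedProd ha T) fun h0 => hg ?_
      have hs := hasSupport_orderedProd ha T
      rw [h0] at hs
      obtain ⟨k, hk⟩ := hs.exists_eq_sgn_mul HasSupport.one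
      rw [mul_one] at hk
      have hT0 := hp.eq_empty_of_orderedProd_eq_sgn hk
      refine Subtype.ext (hT.symm.trans ?_)
      simp [hT0, orderedProd]
    · exact fun h => absurd (Finset.mem_univ _) h
  refine ⟨((2 ^ l : ℝ)⁻¹) • σ, ?_, by rw [map_smul, hconj], ?_⟩
  · rw [smul_mul_smul_comm, hσ, smul_smul, mul_assoc, inv_mul_cancel₀ h2, mul_one]
  · rw [map_smul, htrace, smul_eq_mul, mul_inv_cancel_left₀ h2]

/-- The dimension of the minimal admissible modules. -/
theorem two_pow_mul_minAdmissibleDim {l : ℕ} (hl : IsGreatest (piCards r s) l) :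
    2 ^ l * minAdmissibleDim r s = 2 ^ (r + s) := by
  obtain ⟨p, hp⟩ := hl.1
  obtain ⟨e, he, hconj, htrace⟩ := hp.exists_idempotent
  rw [← finrank_span_singleton_idempotent he] at htrace
  have hdim : 2 ^ l * Module.finrank ℝ (Submodule.span (Cl r s) {e}) = 2 ^ (r + s) := by
    exact_mod_cast htrace
  have hpos : 0 < Module.finrank ℝ (Submodule.span (Cl r s) {e}) := by
    refine Nat.pos_of_ne_zero fun h => ?_
    rw [h, mul_zero] at hdim
    exact (pow_pos two_pos _).ne hdim
  have hmem : Module.finrank ℝ (Submodule.span (Cl r s) {e}) ∈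
      {N : ℕ | ∃ (V : Type) (_ : AddCommGroup V) (_ : Module ℝ V) (_ : FiniteDimensional ℝ V)
        (_ : Nontrivial V) (J : Cl r s →ₐ[ℝ] Module.End ℝ V) (B : LinearMap.BilinForm ℝ V),
        IsAdmissible J B ∧ Module.finrank ℝ V = N} :=
    ⟨_, inferInstance, inferInstance, Module.finite_of_finrank_pos hpos,
      Module.nontrivial_of_finrank_pos hpos, _, _, isAdmissible_conjForm he hconj, rfl⟩
  -- The ideal bounds the minimal dimension from above; the coset count applied to a module
  -- attaining the minimum bounds it from below.
  refine le_antisymm ((Nat.mul_le_mul_left _ (Nat.sInf_le hmem)).trans_eq hdim) ?_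
  rw [piCards_eq_codeDims] at hl
  obtain ⟨C, hC, hCl⟩ := hl.1
  obtain ⟨V, _, _, _, _, J, B, hJ, hN⟩ := Nat.sInf_mem ⟨_, hmem⟩
  rw [← hCl] at hl ⊢
  exact (hJ.two_pow_le_finrank_mul hC hl).trans_eq (congrArg _ hN)

/-! ### Equality of the two maxima and periodicity of `ell`. -/

theorem isGreatest_piCards_and_maxPiCards (r s : ℕ) :
    IsGreatest (maxPiCards r s) (ell r s) ∧ IsGreatest (piCards r s) (ell r s) := by
  obtain ⟨l, hl⟩ := exists_isGreatest_codeDims (negInd r s)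
  rw [← piCards_eq_codeDims] at hl
  have hdim := two_pow_mul_minAdmissibleDim hl
  have hmax : IsGreatest (maxPiCards r s) l := by
    refine ⟨?_, fun m ⟨p, hp⟩ => hl.2 ⟨p, hp.isPI⟩⟩
    obtain ⟨p, hp⟩ := hl.1
    refine ⟨p, hp, ?_⟩
    rw [hp.card_closure, mul_left_comm, hdim, pow_succ']
  rw [ell, hmax.csSup_eq]
  exact ⟨hmax, hl⟩

theorem ell_eq_of_isGreatest_codeDims {l : ℕ} (hl : IsGreatest (codeDims (negInd r s)) l) :
    ell r s = l := by
  rw [← piCards_eq_codeDims] at hl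
  exact (isGreatest_piCards_and_maxPiCards r s).2.unique hl

theorem isGreatest_codeDims_ell (r s : ℕ) : IsGreatest (codeDims (negInd r s)) (ell r s) := by
  rw [← piCards_eq_codeDims]
  exact (isGreatest_piCards_and_maxPiCards r s).2

theorem ell_add_eight_left (r s : ℕ) : ell (r + 8) s = ell r s + 4 :=
  ell_eq_of_isGreatest_codeDims (isGreatest_codeDims_eight_zero (isGreatest_codeDims_ell r s))

theorem ell_add_eight_right (r s : ℕ) : ell r (s + 8) = ell r s + 4 :=
  ell_eq_of_isGreatest_codeDims (isGreatest_codeDims_zero_eight (isGreatest_codeDims_ell r s))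

theorem ell_add_four_four (r s : ℕ) : ell (r + 4) (s + 4) = ell r s + 4 :=
  ell_eq_of_isGreatest_codeDims (isGreatest_codeDims_four_four (isGreatest_codeDims_ell r s))

theorem ell_zero_zero : ell 0 0 = 0 := by
  simpa using le_card_of_mem_codeDims (isGreatest_codeDims_ell 0 0).1

end PseudoH

theorem mainTheorem11 :
    (∀ r s : ℕ, IsGreatest (PseudoH.maxPiCards r s) (PseudoH.ell r s) ∧
      IsGreatest (PseudoH.piCards r s) (PseudoH.ell r s)) ∧
    (∀ r s : ℕ,
      PseudoH.ell (r + 8) s = PseudoH.ell r s + 4 ∧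
      PseudoH.ell (r + 4) (s + 4) = PseudoH.ell r s + 4 ∧
      PseudoH.ell r (s + 8) = PseudoH.ell r s + 4 ∧
      PseudoH.ell r s + 4 = PseudoH.ell r s + PseudoH.ell 8 0 ∧
      PseudoH.ell r s + 4 = PseudoH.ell r s + PseudoH.ell 0 8 ∧
      PseudoH.ell r s + 4 = PseudoH.ell r s + PseudoH.ell 4 4) := by
  have h80 := PseudoH.ell_add_eight_left 0 0
  have h08 := PseudoH.ell_add_eight_right 0 0
  have h44 := PseudoH.ell_add_four_four 0 0
  simp only [zero_add, PseudoH.ell_zero_zero] at h80 h08 h44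
  refine ⟨PseudoH.isGreatest_piCards_and_maxPiCards, fun r s =>
    ⟨PseudoH.ell_add_eight_left r s, PseudoH.ell_add_four_four r s,
      PseudoH.ell_add_eight_right r s, ?_, ?_, ?_⟩⟩
  · rw [h80]
  · rw [h08]
  · rw [h44]
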